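/- **Setting.** Let $\Omega\subseteq\mathbb R^{d}$ be open and bounded and let $E(\mu)=\sum_i f_i(\mu)E_i$, $A(\mu)=\sum_i g_i(\mu)A_i$, $B(\mu)=\sum_i h_i(\mu)B_i$, $C(\mu)=\sum_i k_i(\mu)C_i$ be finite sums with real matrices $E_i,A_i\in\mathbb R^{n\times n}$, $B_i\in\mathbb R^{n\times m}$, $C_i\in\mathbb R^{p\times n}$ and real-analytic $f_i,g_i,h_i,k_i:\Omega\to\mathbb R$. Put $D(\mu,s)=sE(\mu)-A(\mu)$ and let $H[\mu](s)=C(\mu)D(\mu,s)^{-1}B(\mu)$, a matrix of rational functions of $s$, defined if the pencil $D(\mu,\cdot)$ is regular. For a matrix let $\sigma_{\min}$ be its smallest singular value, and let $\sigma(\mu,\omega)$ and $\sigma_2(\mu,\omega)$ be the largest and second largest singular values of $H[\mu](\mathrm i\omega)$, $\omega\in\mathbb R$ (with $\sigma_2=0$ if there is only one). Let $\|H[\mu]\|_{\mathcal H_\infty}=\sup_{\operatorname{Re}s>0}\|H[\mu](s)\|_2$; we write $H[\mu]\in\mathcal H_\infty$ if $D(\mu,\cdot)$ is regular and this supremum is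 finite. Subscripts $\omega$ denote partial derivatives. For $V,W\in\mathbb C^{n\times r}$ with orthonormal columns, spanning $\mathcal V,\mathcal W$, let $D^{V,W}(\mu,s)=W^*D(\mu,s)V$, $H^{\mathcal V,\mathcal W}[\mu](s)=C(\mu)V\,D^{V,W}(\mu,s)^{-1}\,W^*B(\mu)$, and let $\sigma^{\mathcal V,\mathcal W},\sigma_2^{\mathcal V,\mathcal W}$ be the two largest singular values of $H^{\mathcal V,\mathcal W}[\mu](\mathrm i\omega)$. Closed balls are written $\overline{\mathcal B}(\cdot,\eta)$ (Euclidean norm). Because the data are real, $\sigma(\mu,-\omega)=\sigma(\mu,\omega)$. We say that $w\in\mathbb R$ is *the unique global maximizer of $\sigma(\mu,\cdot)$* if $\sigma(\mu,\omega)<\sigma(\mu,w)$ for every $\omega\in\mathbb R$ with $|\omega|\ne|w|$ and also $\lim_{|\omega|\to\infty}\sigma(\mu,\omega)<\sigma(\mu,w)$; that is, $w$ is unique on $\mathbb R\cup\{\infty\}$ up to its sign. **Algorithms.** Let $\underline\Omega\subseteq\Omega$ be compact. Both algorithms start with subspaces $\mathcal V_0,\mathcal W_0\subseteq\mathbb C^n$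 (possibly zero). In step $j=1,2,\dots$ they choose $\mu^{(j)}$ as a minimizer over $\mu\in\underline\Omega$ of $\sup_{\omega\in\mathbb R}\sigma^{\mathcal V_{j-1},\mathcal W_{j-1}}(\mu,\omega)$ (taken to be $+\infty$ where the reduced pencil is not regular), choose $\omega^{(j)}\in\mathbb R$ as a global maximizer of $\sigma(\mu^{(j)},\cdot)$, with $D(\mu^{(j)},\mathrm i\omega^{(j)})$ invertible, and add to $\mathcal V_{j-1}$ and $\mathcal W_{j-1}$ the column spaces of $\widetilde V(\mu^{(j)},\omega^{(j)})$ and $\widetilde W(\mu^{(j)},\omega^{(j)})$. Here, with all matrices evaluated at $(\mu,\mathrm i\omega)$, $\widetilde V(\mu,\omega)$ is $D^{-1}B$ if $m\le p$ and $D^{-1}BH^*$ if $m>p$, and $\widetilde W(\mu,\omega)$ is $D^{-*}C^*$ if $m\ge p$ and $D^{-*}C^*H$ if $m<p$. In the basic algorithm the results are $\mathcal V_j,\mathcal W_j$. The extended algorithm, for $j\ge2$, also adds the column spaces of $\widetilde V(\mu^{(j,rq)},\omega^{(j,rq)})$ and $\widetilde W(\mu^{(j,rq)},\omega^{(j,rq)})$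 for all $1\le r\le q\le d$, where $\mu^{(j,rq)}=\mu^{(j)}+\|\mu^{(j)}-\mu^{(j-1)}\|_2\,e_{rq}\in\Omega$, $e_{rr}=e_r$, $e_{rq}=(e_r+e_q)/\sqrt2$ for $r\neq q$, and $\omega^{(j,rq)}\in\mathbb R$ is a global maximizer of $\sigma(\mu^{(j,rq)},\cdot)$ with $D(\mu^{(j,rq)},\mathrm i\omega^{(j,rq)})$ invertible. In each step $\mathcal V_j$ and $\mathcal W_j$ are assumed to have equal dimension, and $V_j,W_j$ are matrices whose columns form orthonormal bases of them. **Assumptions.** $H[\mu]\in\mathcal H_\infty$ for all $\mu\in\underline\Omega$; $\mu_*\in\underline\Omega$ is a local (or global) minimizer of $\|H[\cdot]\|_{\mathcal H_\infty}$ over $\underline\Omega$; $H[\mu]\in\mathcal H_\infty$ for all $\mu$ in a neighbourhood of $\mu_*$; and $\sigma$, extended to $\omega=\infty$ by its limit, is continuous at all points of $\{\mu_*\}\times(\mathbb R\cup\{\infty\})$, that is, $\sigma(\mu,\cdot)\to\sigma(\mu_*,\cdot)$ uniformly on $\mathbb R$ as $\mu\to\mu_*$. (Smoothness) $\sigma(\mu_*,\cdot)$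 has the unique global maximizer $\omega_*\in\mathbb R$, and $\sigma(\mu_*,\omega_*)>0$ is a simple singular value of $H[\mu_*](\mathrm i\omega_*)$. Fix $k\ge1$ and an arbitrary family of runs of the two algorithms (through step $k$) for which $\mu^{(k)}\to\mu_*$ as $\mu^{(1)}\to\mu_*$ and, if $\omega_*\ne0$, the sign of $\omega^{(k)}$ is chosen such that $\omega^{(k)}\omega_*\ge0$. Finally let $\delta<0$ and $\beta>0$ with $\sigma_{\omega\omega}(\mu_*,\omega_*)\le\delta$ and $\sigma_{\min}(D(\mu_*,\mathrm i\omega_*))\ge\beta$. **Proposition.** There are $\rho,\eta_{\mu,0},\eta_{\omega,0},\varepsilon>0$, the same for all runs of the family, with $\overline{\mathcal B}(\mu_*,\eta_{\mu,0})\subseteq\Omega$, such that the following holds. Parts (i) and (iii) concern the full system only; (ii) and (iv) hold for each run of the family with $\|\mu^{(1)}-\mu_*\|_2<\rho$, $\sigma^{\mathcal V_k,\mathcal W_k}_{\omega\omega}(\mu_*,\omega_*)\le\delta$ and $\sigma_{\min}(D^{V_k,W_k}(\mu_*,\mathrm i\omega_*))\ge\beta$. (i) There is a unique continuous function $\boldsymbol\omega:\overline{\mathcal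 B}(\mu_*,\eta_{\mu,0})\to\overline{\mathcal B}(\omega_*,\eta_{\omega,0})$, three times continuously differentiable in the interior, with $\boldsymbol\omega(\mu_*)=\omega_*$ and $\sigma_\omega(\mu,\boldsymbol\omega(\mu))=0$ for all $\mu\in\overline{\mathcal B}(\mu_*,\eta_{\mu,0})$. Moreover, for all these $\mu$, $\sigma(\mu,\cdot)$ is twice continuously differentiable at $\boldsymbol\omega(\mu)$ and $\sigma_{\omega\omega}(\mu,\boldsymbol\omega(\mu))\le\delta/2$. (ii) $\mu^{(k)}\in\overline{\mathcal B}(\mu_*,\eta_{\mu,0})$, and there is a unique continuous function $\boldsymbol\omega^{\mathcal V_k,\mathcal W_k}:\overline{\mathcal B}(\mu_*,\eta_{\mu,0})\to\overline{\mathcal B}(\omega_*,\eta_{\omega,0})$, three times continuously differentiable in the interior, with $\boldsymbol\omega^{\mathcal V_k,\mathcal W_k}(\mu^{(k)})=\omega^{(k)}$ and $\sigma^{\mathcal V_k,\mathcal W_k}_\omega(\mu,\boldsymbol\omega^{\mathcal V_k,\mathcal W_k}(\mu))=0$ for all $\mu\in\overline{\mathcal B}(\mu_*,\eta_{\mu,0})$.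 Moreover, for all these $\mu$, $\sigma^{\mathcal V_k,\mathcal W_k}(\mu,\cdot)$ is twice continuously differentiable at $\boldsymbol\omega^{\mathcal V_k,\mathcal W_k}(\mu)$ and $\sigma^{\mathcal V_k,\mathcal W_k}_{\omega\omega}(\mu,\boldsymbol\omega^{\mathcal V_k,\mathcal W_k}(\mu))\le\delta/2$. (iii) For all $\mu\in\overline{\mathcal B}(\mu_*,\eta_{\mu,0})$: $\sigma(\mu,\boldsymbol\omega(\mu))-\sigma_2(\mu,\boldsymbol\omega(\mu))\ge\varepsilon$, the unique global maximizer of $\sigma(\mu,\cdot)$ is $\boldsymbol\omega(\mu)$ (and $\boldsymbol\omega(\mu)=0$ if $\omega_*=0$), and $\|H[\mu]\|_{\mathcal H_\infty}=\sigma(\mu,\boldsymbol\omega(\mu))$. (iv) For all $\mu\in\overline{\mathcal B}(\mu_*,\eta_{\mu,0})$: $\sigma^{\mathcal V_k,\mathcal W_k}(\mu,\boldsymbol\omega^{\mathcal V_k,\mathcal W_k}(\mu))-\sigma_2^{\mathcal V_k,\mathcal W_k}(\mu,\boldsymbol\omega^{\mathcal V_k,\mathcal W_k}(\mu))\ge\varepsilon$,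 and $\boldsymbol\omega^{\mathcal V_k,\mathcal W_k}(\mu)$ is the unique maximizer and the unique stationary point of $\sigma^{\mathcal V_k,\mathcal W_k}(\mu,\cdot)$ in $\overline{\mathcal B}(\omega_*,\eta_{\omega,0})$. -/

import Mathlib

open Set Filter Topology Metric
open scoped Matrix ENNReal

namespace HinfMin

noncomputable section

/-! ### Singular values of complex matrices -/

/-- The `i`-th largest singular value (counted from `0`, with multiplicity, with respect to the
Euclidean norms) of a complex matrix; it is `0` once the singular values are exhausted. -/
def sval {p m : ℕ} (M : Matrix (Fin p) (Fin m) ℂ) (i : ℕ) : ℝ :=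
  (Matrix.toEuclideanLin M).singularValues i

/-- The largest singular value, that is, the spectral norm. -/
def svalMax {p m : ℕ} (M : Matrix (Fin p) (Fin m) ℂ) : ℝ := sval M 0

/-- The second largest singular value. -/
def svalSecond {p m : ℕ} (M : Matrix (Fin p) (Fin m) ℂ) : ℝ := sval M 1

/-- The smallest singular value of a square matrix. -/
def svalMin {r : ℕ} (M : Matrix (Fin r) (Fin r) ℂ) : ℝ := sval M (r - 1)

/-! ### Transfer functions -/

/-- The pencil `s E - A` is regular. -/
def RegularPencil {r : ℕ} (E A : Matrix (Fin r) (Fin r) ℂ) : Prop :=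
  ∃ z : ℂ, (z • E - A).det ≠ 0

/-- The transfer function `C (s E - A)⁻¹ B`, as a matrix of rational functions of `s`. -/
def transfer {r m p : ℕ} (E A : Matrix (Fin r) (Fin r) ℂ) (B : Matrix (Fin r) (Fin m) ℂ)
    (C : Matrix (Fin p) (Fin r) ℂ) : Matrix (Fin p) (Fin m) (RatFunc ℂ) :=
  C.map RatFunc.C *
    ((RatFunc.X : RatFunc ℂ) • E.map RatFunc.C - A.map RatFunc.C)⁻¹ * B.map RatFunc.C

/-- The value at `s` of a matrix of rational functions; the entries are evaluated in lowest terms,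
so removable singularities are removed. -/
def evalAt {p m : ℕ} (H : Matrix (Fin p) (Fin m) (RatFunc ℂ)) (s : ℂ) :
    Matrix (Fin p) (Fin m) ℂ :=
  H.map (RatFunc.eval (RingHom.id ℂ) s)

/-- The column space of a matrix. -/
def col {n m : ℕ} (M : Matrix (Fin n) (Fin m) ℂ) : Submodule ℂ (Fin n → ℂ) :=
  LinearMap.range M.mulVecLin

/-- A real matrix, viewed as a complex one. -/
def cplx {p m : ℕ} (M : Matrix (Fin p) (Fin m) ℝ) : Matrix (Fin p) (Fin m) ℂ :=
  M.map (fun x : ℝ => (x : ℂ))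

/-! ### Parameter-dependent descriptor systems -/

/-- A descriptor system of order `n` with `m` inputs and `p` outputs that depends on `d` real
parameters through finitely many real-analytic coefficient functions on an open bounded set. -/
structure ParamSystem (d n m p : ℕ) where
  Ω : Set (EuclideanSpace ℝ (Fin d))
  isOpen_Ω : IsOpen Ω
  isBounded_Ω : Bornology.IsBounded Ω
  κE : ℕ
  κA : ℕ
  κB : ℕ
  κC : ℕ
  f : Fin κE → EuclideanSpace ℝ (Fin d) → ℝ
  g : Fin κA → EuclideanSpace ℝ (Fin d) → ℝ
  h : Fin κB → EuclideanSpace ℝ (Fin d) → ℝ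
  k : Fin κC → EuclideanSpace ℝ (Fin d) → ℝ
  analytic_f : ∀ i, AnalyticOnNhd ℝ (f i) Ω
  analytic_g : ∀ i, AnalyticOnNhd ℝ (g i) Ω
  analytic_h : ∀ i, AnalyticOnNhd ℝ (h i) Ω
  analytic_k : ∀ i, AnalyticOnNhd ℝ (k i) Ω
  matE : Fin κE → Matrix (Fin n) (Fin n) ℝ
  matA : Fin κA → Matrix (Fin n) (Fin n) ℝ
  matB : Fin κB → Matrix (Fin n) (Fin m) ℝ
  matC : Fin κC → Matrix (Fin p) (Fin n) ℝ

namespace ParamSystem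

variable {d n m p : ℕ} (S : ParamSystem d n m p)

/-! #### The full system -/

def E (μ : EuclideanSpace ℝ (Fin d)) : Matrix (Fin n) (Fin n) ℝ := ∑ i, S.f i μ • S.matE i

def A (μ : EuclideanSpace ℝ (Fin d)) : Matrix (Fin n) (Fin n) ℝ := ∑ i, S.g i μ • S.matA i

def B (μ : EuclideanSpace ℝ (Fin d)) : Matrix (Fin n) (Fin m) ℝ := ∑ i, S.h i μ • S.matB i

def C (μ : EuclideanSpace ℝ (Fin d)) : Matrix (Fin p) (Fin n) ℝ := ∑ i, S.k i μ • S.matC i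

/-- `D(μ, s) = s E(μ) - A(μ)`. -/
def D (μ : EuclideanSpace ℝ (Fin d)) (s : ℂ) : Matrix (Fin n) (Fin n) ℂ :=
  s • cplx (S.E μ) - cplx (S.A μ)

/-- The value `H[μ](s)` of the transfer function. -/
def H (μ : EuclideanSpace ℝ (Fin d)) (s : ℂ) : Matrix (Fin p) (Fin m) ℂ :=
  evalAt (transfer (cplx (S.E μ)) (cplx (S.A μ)) (cplx (S.B μ)) (cplx (S.C μ))) s

/-- `σ(μ, ω)`, the largest singular value of `H[μ](iω)`. -/
def sigma (μ : EuclideanSpace ℝ (Fin d)) (ω : ℝ) : ℝ := svalMax (S.H μ (Complex.I * ω))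

/-- `σ₂(μ, ω)`, the second largest singular value of `H[μ](iω)`. -/
def sigmaSecond (μ : EuclideanSpace ℝ (Fin d)) (ω : ℝ) : ℝ := svalSecond (S.H μ (Complex.I * ω))

/-- The supremum of `‖H[μ](s)‖₂` over the open right half-plane; near a pole the supremum
is infinite. -/
def hInfNorm (μ : EuclideanSpace ℝ (Fin d)) : ℝ≥0∞ :=
  ⨆ s : {s : ℂ // 0 < s.re}, ENNReal.ofReal (svalMax (S.H μ s))

/-- The transfer function `H[μ]` is defined and belongs to the Hardy space. -/
def InHinf (μ : EuclideanSpace ℝ (Fin d)) : Prop :=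
  RegularPencil (cplx (S.E μ)) (cplx (S.A μ)) ∧ S.hInfNorm μ < ⊤

/-! #### Reduced systems -/

section Reduced

variable {r : ℕ} (V W : Matrix (Fin n) (Fin r) ℂ)

def redE (μ : EuclideanSpace ℝ (Fin d)) : Matrix (Fin r) (Fin r) ℂ :=
  ∑ i, (S.f i μ : ℂ) • (Wᴴ * cplx (S.matE i) * V)

def redA (μ : EuclideanSpace ℝ (Fin d)) : Matrix (Fin r) (Fin r) ℂ :=
  ∑ i, (S.g i μ : ℂ) • (Wᴴ * cplx (S.matA i) * V)

def redB (μ : EuclideanSpace ℝ (Fin d)) : Matrix (Fin r) (Fin m) ℂ :=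
  ∑ i, (S.h i μ : ℂ) • (Wᴴ * cplx (S.matB i))

def redC (μ : EuclideanSpace ℝ (Fin d)) : Matrix (Fin p) (Fin r) ℂ :=
  ∑ i, (S.k i μ : ℂ) • (cplx (S.matC i) * V)

def redD (μ : EuclideanSpace ℝ (Fin d)) (s : ℂ) : Matrix (Fin r) (Fin r) ℂ :=
  s • S.redE V W μ - S.redA V W μ

def redH (μ : EuclideanSpace ℝ (Fin d)) (s : ℂ) : Matrix (Fin p) (Fin m) ℂ :=
  evalAt (transfer (S.redE V W μ) (S.redA V W μ) (S.redB W μ) (S.redC V μ)) s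

def redSigma (μ : EuclideanSpace ℝ (Fin d)) (ω : ℝ) : ℝ :=
  svalMax (S.redH V W μ (Complex.I * ω))

def redSigmaSecond (μ : EuclideanSpace ℝ (Fin d)) (ω : ℝ) : ℝ :=
  svalSecond (S.redH V W μ (Complex.I * ω))

open Classical in
/-- The norm minimized by the algorithms: the supremum over the imaginary axis, since reduced
systems need not be stable. It is infinite where the reduced transfer function is undefined. -/
def redNorm (μ : EuclideanSpace ℝ (Fin d)) : ℝ≥0∞ :=
  if RegularPencil (S.redE V W μ) (S.redA V W μ) then
    ⨆ ω : ℝ, ENNReal.ofReal (S.redSigma V W μ ω)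
  else ⊤

end Reduced

/-! #### The interpolation subspaces of the algorithms -/

/-- `Col(D(μ,iω)⁻¹ B(μ))` if `m ≤ p`, and `Col(D(μ,iω)⁻¹ B(μ) H[μ](iω)*)` if `m > p`. -/
def newV (μ : EuclideanSpace ℝ (Fin d)) (ω : ℝ) : Submodule ℂ (Fin n → ℂ) :=
  if m ≤ p then col ((S.D μ (Complex.I * ω))⁻¹ * cplx (S.B μ))
  else col ((S.D μ (Complex.I * ω))⁻¹ * cplx (S.B μ) * (S.H μ (Complex.I * ω))ᴴ)

/-- `Col(D(μ,iω)⁻* C(μ)*)` if `m ≥ p`, and `Col(D(μ,iω)⁻* C(μ)* H[μ](iω))` if `m < p`. -/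
def newW (μ : EuclideanSpace ℝ (Fin d)) (ω : ℝ) : Submodule ℂ (Fin n → ℂ) :=
  if p ≤ m then col (((S.D μ (Complex.I * ω))⁻¹)ᴴ * (cplx (S.C μ))ᴴ)
  else col (((S.D μ (Complex.I * ω))⁻¹)ᴴ * (cplx (S.C μ))ᴴ * S.H μ (Complex.I * ω))

/-- `ω` is a (finite) global maximizer of `σ(μ, ·)` at which the interpolation subspaces can be
formed. As the value of `σ(μ, ·)` at infinity is a limit, a finite maximizer over the real
line is a maximizer over the real line with infinity added. -/
def IsPeak (μ : EuclideanSpace ℝ (Fin d)) (ω : ℝ) : Prop :=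
  (∀ ω', S.sigma μ ω' ≤ S.sigma μ ω) ∧ IsUnit (S.D μ (Complex.I * ω)).det

end ParamSystem

/-! ### Runs of the algorithms -/

/-- The quantities that a run of one of the algorithms produces. The columns of `V j` and `W j`
form bases of the `j`-th pair of subspaces (which therefore have the same dimension `r j`); `V 0`,
`W 0` are the initial ones. The iterates are `μ j`, `ω j` for `j ≥ 1`, and `ωadj j a b` are the
frequencies used at the additional points of the extended algorithm. -/
structure Run (d n : ℕ) where
  r : ℕ → ℕ
  V : (j : ℕ) → Matrix (Fin n) (Fin (r j)) ℂ
  W : (j : ℕ) → Matrix (Fin n) (Fin (r j)) ℂ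
  μ : ℕ → EuclideanSpace ℝ (Fin d)
  ω : ℕ → ℝ
  ωadj : ℕ → Fin d → Fin d → ℝ

/-- `e_a` if `a = b` and `(e_a + e_b) / √2` otherwise. -/
def adjDir {d : ℕ} (a b : Fin d) : EuclideanSpace ℝ (Fin d) :=
  if a = b then EuclideanSpace.single a 1
  else (1 / √2 : ℝ) • (EuclideanSpace.single a 1 + EuclideanSpace.single b 1)

namespace Run

variable {d n : ℕ} (R : Run d n)

/-- The additional points `μ^(j) + ‖μ^(j) - μ^(j-1)‖ e_ab` of the extended algorithm. -/
def μadj (j : ℕ) (a b : Fin d) : EuclideanSpace ℝ (Fin d) :=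
  R.μ j + ‖R.μ j - R.μ (j - 1)‖ • adjDir a b

variable {m p : ℕ} (S : ParamSystem d n m p) (K : Set (EuclideanSpace ℝ (Fin d)))

/-- The columns of `V j` and of `W j` are orthonormal. -/
def Orthonormal (j : ℕ) : Prop := (R.V j)ᴴ * R.V j = 1 ∧ (R.W j)ᴴ * R.W j = 1

/-- The choice of the iterates at step `j ≥ 1`: `μ^(j)` minimizes the norm of the previous reduced
system over `K`, and `ω^(j)` maximizes `σ(μ^(j), ·)`. -/
def Selects (j : ℕ) : Prop :=
  R.μ j ∈ K ∧
  (∀ μ' ∈ K, S.redNorm (R.V (j - 1)) (R.W (j - 1)) (R.μ j) ≤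
    S.redNorm (R.V (j - 1)) (R.W (j - 1)) μ') ∧
  S.IsPeak (R.μ j) (R.ω j)

/-- The first `k` steps of `R` are steps of the basic greedy algorithm for the minimization of the
norm of the system `S` over `K`. -/
def IsBasic (k : ℕ) : Prop :=
  (∀ j ≤ k, R.Orthonormal j) ∧
  ∀ j, 1 ≤ j → j ≤ k →
    R.Selects S K j ∧
    col (R.V j) = col (R.V (j - 1)) ⊔ S.newV (R.μ j) (R.ω j) ∧
    col (R.W j) = col (R.W (j - 1)) ⊔ S.newW (R.μ j) (R.ω j)

/-- The first `k` steps of `R` are steps of the extended greedy algorithm for the minimization of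
the norm of the system `S` over `K`: from the second step on, the subspaces are also enlarged at
the additional points. -/
def IsExtended (k : ℕ) : Prop :=
  (∀ j ≤ k, R.Orthonormal j) ∧
  ∀ j, 1 ≤ j → j ≤ k →
    R.Selects S K j ∧
    (2 ≤ j → ∀ a b, a ≤ b →
      R.μadj j a b ∈ S.Ω ∧ S.IsPeak (R.μadj j a b) (R.ωadj j a b)) ∧
    col (R.V j) = col (R.V (j - 1)) ⊔ S.newV (R.μ j) (R.ω j) ⊔
      (⨆ (_ : 2 ≤ j) (a) (b) (_ : a ≤ b), S.newV (R.μadj j a b) (R.ωadj j a b)) ∧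
    col (R.W j) = col (R.W (j - 1)) ⊔ S.newW (R.μ j) (R.ω j) ⊔
      (⨆ (_ : 2 ≤ j) (a) (b) (_ : a ≤ b), S.newW (R.μadj j a b) (R.ωadj j a b))

end Run

/-! ### Maximizers and stationary branches -/

/-- The supremum of the even function `s` over the real line with infinity added is attained at
`w` and, apart from the mirror image `-w`, nowhere else; `s` has a limit at infinity in the cases
of interest, so the second clause says that this limit is smaller than `s w`. -/
def IsUniqueMax (s : ℝ → ℝ) (w : ℝ) : Prop :=
  (∀ ω, |ω| ≠ |w| → s ω < s w) ∧ ∃ c < s w, ∀ᶠ ω in cocompact ℝ, s ω ≤ c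

/-- On the closed ball of radius `a` about `μs`, the function `w` is continuous with values in
the closed interval of radius `b` about `ωs`, three times continuously differentiable in the
interior, takes the value `ω₀` at the point `μ₀` of the ball, and `w μ` is a stationary point
of `s μ` for each `μ`. -/
structure IsStationaryBranch {d : ℕ} (s : EuclideanSpace ℝ (Fin d) → ℝ → ℝ)
    (μs : EuclideanSpace ℝ (Fin d)) (ωs a b : ℝ) (μ₀ : EuclideanSpace ℝ (Fin d)) (ω₀ : ℝ)
    (w : EuclideanSpace ℝ (Fin d) → ℝ) : Prop where
  continuousOn : ContinuousOn w (closedBall μs a)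
  mapsTo : MapsTo w (closedBall μs a) (closedBall ωs b)
  contDiffOn : ContDiffOn ℝ 3 w (ball μs a)
  mem_base : μ₀ ∈ closedBall μs a
  eq_base : w μ₀ = ω₀
  stationary : ∀ μ ∈ closedBall μs a, HasDerivAt (s μ) 0 (w μ)

/-- `w` is the only stationary branch, up to its irrelevant values outside the ball. -/
def IsUniqueStationaryBranch {d : ℕ} (s : EuclideanSpace ℝ (Fin d) → ℝ → ℝ)
    (μs : EuclideanSpace ℝ (Fin d)) (ωs a b : ℝ) (μ₀ : EuclideanSpace ℝ (Fin d)) (ω₀ : ℝ)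
    (w : EuclideanSpace ℝ (Fin d) → ℝ) : Prop :=
  IsStationaryBranch s μs ωs a b μ₀ ω₀ w ∧
  ∀ w', IsStationaryBranch s μs ωs a b μ₀ ω₀ w' → EqOn w' w (closedBall μs a)

/-- `s` is twice continuously differentiable at `ω` with second derivative at most `c`. -/
def SecondDerivLE (s : ℝ → ℝ) (ω c : ℝ) : Prop :=
  ContDiffAt ℝ 2 s ω ∧ deriv (deriv s) ω ≤ c

end

end HinfMin

open HinfMin

/-!
For projection matrices `V`, `W` with orthonormal columns, `σ_min(D^{V,W}(μs, i ωs)) ≥ β`, a gap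
`σ₁ - σ₂ ≥ 2 γ` and second derivative at most `δ` at the base point form a compact set, on which
`σ^{V,W}` is smooth. Hence on one box about `(μs, ωs)` all the functions `σ^{V,W}(μ, ·)` are
strictly concave, and every stationary point near `ωs` lies on a branch of strict maximizers, which
is smooth by the implicit function theorem. The full system is the pair `V = W = 1`.

The reduced transfer function agrees with the full one at the interpolation point
`(μ^(k), i ω^(k))`, so that the gap there is the one of the full system. With singular vectors `u`,
`v` for `σ`, the function `ω ↦ Re (u* H^{V,W} v)` lies below `σ^{V,W}`, touches it at `ω^(k)`, and
has there the same derivative as `Re (u* H v)`, which vanishes because `ω^(k)` is a maximizer. So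
`ω^(k)` is stationary for `σ^{V,W}`, and the box provides the branch through it.

Unique global maximality of `ωs` persists by uniform convergence, and the norm is the maximum over
the imaginary axis by the Phragmén–Lindelöf principle.
-/

namespace HinfMin

/-! ### Uniform families of concave stationary branches -/

section PartialDerivative

variable {X : Type*} [NormedAddCommGroup X] [NormedSpace ℝ X] {F : X × ℝ → ℝ} {z : X × ℝ}

theorem hasDerivAt_snd (h : DifferentiableAt ℝ F z) :
    HasDerivAt (fun t => F (z.1, t)) (fderiv ℝ F z (0, 1)) z.2 :=
  HasFDerivAt.comp_hasDerivAt (f := fun t : ℝ => (z.1, t)) z.2 h.hasFDerivAt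
    ((hasDerivAt_const _ _).prodMk (hasDerivAt_id _))

theorem contDiffAt_deriv_snd {n : ℕ} (h : ContDiffAt ℝ (n + 1) F z) :
    ContDiffAt ℝ n (fun y : X × ℝ => deriv (fun t => F (y.1, t)) y.2) z := by
  have hfderiv : ContDiffAt ℝ n (fun y => fderiv ℝ F y (0, 1)) z :=
    (h.fderiv_right le_rfl).clm_apply contDiffAt_const
  refine hfderiv.congr_of_eventuallyEq ?_
  filter_upwards [h.eventually (by exact_mod_cast ENat.natCast_ne_top (n + 1))] with y hy
  exact (hasDerivAt_snd (hy.differentiableAt (by simp))).deriv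

theorem isInvertible_fderiv_inr (h : DifferentiableAt ℝ F z)
    (hne : deriv (fun t => F (z.1, t)) z.2 ≠ 0) :
    (fderiv ℝ F z ∘L ContinuousLinearMap.inr ℝ X ℝ).IsInvertible := by
  rw [(hasDerivAt_snd h).deriv] at hne
  refine ⟨ContinuousLinearEquiv.unitsEquivAut ℝ (Units.mk0 _ hne), ?_⟩
  ext
  simp

theorem contDiffWithinAt_of_unique_zero [CompleteSpace X] {n : WithTop ℕ∞} (hn : n ≠ 0)
    {s : Set X} {w : X → ℝ} {x : X} (hF : ContDiffAt ℝ n F (x, w x))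
    (hne : deriv (fun t => F (x, t)) (w x) ≠ 0) (hzero : F (x, w x) = 0)
    {I : Set ℝ} (hI : I ∈ 𝓝 (w x)) (huniq : ∀ y ∈ s, ∀ t ∈ I, F (y, t) = 0 → t = w y) :
    ContDiffWithinAt ℝ n w s x := by
  have hinv := isInvertible_fderiv_inr (hF.differentiableAt hn) hne
  set ψ := hF.implicitFunction hn hinv
  have hψ : ContDiffAt ℝ n ψ x := hF.contDiffAt_implicitFunction hn hinv
  have hψx : ψ x = w x := hF.implicitFunction_apply_self hn hinv
  have hmem : ∀ᶠ y in 𝓝 x, ψ y ∈ I := hψ.continuousAt (by rwa [hψx])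
  refine hψ.contDiffWithinAt.congr_of_eventuallyEq ?_ hψx.symm
  filter_upwards [(hF.eventually_apply_implicitFunction hn hinv).filter_mono nhdsWithin_le_nhds,
    hmem.filter_mono nhdsWithin_le_nhds, self_mem_nhdsWithin] with y hy hyI hys
  exact (huniq y hys _ hyI (hy.trans hzero)).symm

end PartialDerivative

section ConcaveInterval

theorem lt_of_strictAntiOn_deriv {f : ℝ → ℝ} {s : Set ℝ} (hs : Convex ℝ s) {w : ℝ} (hw : w ∈ s)
    (hf : ∀ x ∈ s, DifferentiableAt ℝ f x) (hanti : StrictAntiOn (deriv f) s)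
    (h0 : deriv f w = 0) : ∀ x ∈ s, x ≠ w → f x < f w := by
  have hcont : ContinuousOn f s := fun x hx => (hf x hx).continuousAt.continuousWithinAt
  intro x hx hxw
  rcases lt_or_gt_of_ne hxw with h | h
  · have hsub : Icc x w ⊆ s := hs.ordConnected.out hx hw
    refine strictMonoOn_of_deriv_pos (convex_Icc x w) (hcont.mono hsub) (fun y hy => ?_)
      (left_mem_Icc.2 h.le) (right_mem_Icc.2 h.le) h
    rw [interior_Icc] at hy
    exact h0 ▸ hanti (hsub (Ioo_subset_Icc_self hy)) hw hy.2
  · have hsub : Icc w x ⊆ s := hs.ordConnected.out hw hx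
    refine strictAntiOn_of_deriv_neg (convex_Icc w x) (hcont.mono hsub) (fun y hy => ?_)
      (left_mem_Icc.2 h.le) (right_mem_Icc.2 h.le) h
    rw [interior_Icc] at hy
    exact h0 ▸ hanti hw (hsub (Ioo_subset_Icc_self hy)) hy.1

theorem endpoint_bounds_of_deriv_le {g : ℝ → ℝ} {x y b c : ℝ} (hc : c ≤ 0)
    (hg : ∀ t ∈ closedBall x b, DifferentiableAt ℝ g t)
    (hg' : ∀ t ∈ closedBall x b, deriv g t ≤ c) (hy : y ∈ closedBall x (b / 2)) (hgy : g y = 0) :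
    -c * (b / 2) ≤ g (x - b) ∧ g (x + b) ≤ c * (b / 2) := by
  have hb : 0 ≤ b / 2 := nonempty_closedBall.1 ⟨y, hy⟩
  have hslope : ∀ s ∈ closedBall x b, ∀ t ∈ closedBall x b, s ≤ t → g t - g s ≤ c * (t - s) :=
    (convex_closedBall x b).image_sub_le_mul_sub_of_deriv_le
      (fun t ht => (hg t ht).continuousAt.continuousWithinAt)
      (fun t ht => (hg t (interior_subset ht)).differentiableWithinAt)
      (fun t ht => hg' t (interior_subset ht))
  rw [Real.closedBall_eq_Icc] at hslope hy
  have hyb : y ∈ Icc (x - b) (x + b) := ⟨by linarith [hy.1], by linarith [hy.2]⟩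
  constructor
  · have := hslope (x - b) ⟨le_rfl, by linarith⟩ y hyb hyb.1
    nlinarith [hy.1]
  · have := hslope y hyb (x + b) ⟨by linarith, le_rfl⟩ hyb.2
    nlinarith [hy.2]

end ConcaveInterval

/-- A unique stationary branch along which `s μ` has second derivative at most `c`, and which
at each parameter `μ` consists of the strict maximizer and only stationary point of `s μ` in the
interval of radius `b` about `ωs`. -/
structure IsConcaveBranch {d : ℕ} (s : EuclideanSpace ℝ (Fin d) → ℝ → ℝ)
    (μs : EuclideanSpace ℝ (Fin d)) (ωs a b c : ℝ) (μ₀ : EuclideanSpace ℝ (Fin d)) (ω₀ : ℝ)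
    (w : EuclideanSpace ℝ (Fin d) → ℝ) : Prop where
  isUnique : IsUniqueStationaryBranch s μs ωs a b μ₀ ω₀ w
  secondDerivLE : ∀ μ ∈ closedBall μs a, SecondDerivLE (s μ) (w μ) c
  lt_of_ne : ∀ μ ∈ closedBall μs a, ∀ ω ∈ closedBall ωs b, ω ≠ w μ → s μ ω < s μ (w μ)
  eq_of_stationary : ∀ μ ∈ closedBall μs a, ∀ ω ∈ closedBall ωs b,
    HasDerivAt (s μ) 0 ω → ω = w μ

section Branch

open Function

theorem exists_isConcaveBranch {d : ℕ} {s : EuclideanSpace ℝ (Fin d) → ℝ → ℝ}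
    {μs μ₀ : EuclideanSpace ℝ (Fin d)} {ωs ω₀ a b c : ℝ} (hc : c < 0)
    (hs : ∀ μ ∈ closedBall μs a, ∀ ω ∈ closedBall ωs b, ContDiffAt ℝ 4 (uncurry s) (μ, ω))
    (hs2 : ∀ μ ∈ closedBall μs a, ∀ ω ∈ closedBall ωs b, deriv (deriv (s μ)) ω ≤ c)
    (hleft : ∀ μ ∈ closedBall μs a, 0 < deriv (s μ) (ωs - b))
    (hright : ∀ μ ∈ closedBall μs a, deriv (s μ) (ωs + b) < 0)
    (hμ₀ : μ₀ ∈ closedBall μs a) (hω₀ : ω₀ ∈ closedBall ωs b) (h₀ : HasDerivAt (s μ₀) 0 ω₀) :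
    ∃ w, IsConcaveBranch s μs ωs a b c μ₀ ω₀ w := by
  have hb : 0 ≤ b := nonempty_closedBall.1 ⟨ω₀, hω₀⟩
  have hs' : ∀ μ ∈ closedBall μs a, ∀ ω ∈ closedBall ωs b,
      ContDiffAt ℝ 3 (fun z : _ × ℝ => deriv (s z.1) z.2) (μ, ω) := fun μ hμ ω hω =>
    contDiffAt_deriv_snd (n := 3) (F := uncurry s) (by convert hs μ hμ ω hω using 1; norm_num)
  have hdiff : ∀ μ ∈ closedBall μs a, ∀ ω ∈ closedBall ωs b, DifferentiableAt ℝ (s μ) ω :=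
    fun μ hμ ω hω => (hasDerivAt_snd
      ((hs μ hμ ω hω).differentiableAt (by norm_num))).differentiableAt
  have hcont : ∀ μ ∈ closedBall μs a, ContinuousOn (deriv (s μ)) (closedBall ωs b) :=
    fun μ hμ ω hω => (hasDerivAt_snd
      ((hs' μ hμ ω hω).differentiableAt (by norm_num))).continuousAt.continuousWithinAt
  have hanti : ∀ μ ∈ closedBall μs a, StrictAntiOn (deriv (s μ)) (closedBall ωs b) :=
    fun μ hμ => strictAntiOn_of_deriv_neg (convex_closedBall ωs b) (hcont μ hμ)
      fun ω hω => (hs2 μ hμ ω (interior_subset hω)).trans_lt hc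
  have hzero : ∀ μ ∈ closedBall μs a, ∃ ω ∈ Ioo (ωs - b) (ωs + b), deriv (s μ) ω = 0 :=
    fun μ hμ => intermediate_value_Ioo' (by linarith)
      (Real.closedBall_eq_Icc (x := ωs) ▸ hcont μ hμ) ⟨hright μ hμ, hleft μ hμ⟩
  choose! w hwIoo hw0 using hzero
  have hwmem : ∀ μ ∈ closedBall μs a, w μ ∈ closedBall ωs b := fun μ hμ =>
    Real.closedBall_eq_Icc (x := ωs) ▸ Ioo_subset_Icc_self (hwIoo μ hμ)
  have huniq : ∀ μ ∈ closedBall μs a, ∀ ω ∈ closedBall ωs b, deriv (s μ) ω = 0 → ω = w μ :=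
    fun μ hμ ω hω h => (hanti μ hμ).injOn hω (hwmem μ hμ) (h.trans (hw0 μ hμ).symm)
  have hsmooth : ContDiffOn ℝ 3 w (closedBall μs a) := fun μ hμ =>
    contDiffWithinAt_of_unique_zero (by norm_num) (hs' μ hμ _ (hwmem μ hμ))
      ((hs2 μ hμ _ (hwmem μ hμ)).trans_lt hc).ne (hw0 μ hμ)
      (Real.closedBall_eq_Icc (x := ωs) ▸ Icc_mem_nhds (hwIoo μ hμ).1 (hwIoo μ hμ).2) huniq
  refine ⟨w, ⟨⟨hsmooth.continuousOn, hwmem, hsmooth.mono ball_subset_closedBall, hμ₀,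
    (huniq μ₀ hμ₀ ω₀ hω₀ h₀.deriv).symm, fun μ hμ => ?_⟩, fun w' hw' μ hμ => ?_⟩,
    fun μ hμ => ⟨?_, hs2 μ hμ _ (hwmem μ hμ)⟩, fun μ hμ => ?_, fun μ hμ ω hω h => ?_⟩
  · exact hw0 μ hμ ▸ (hdiff μ hμ _ (hwmem μ hμ)).hasDerivAt
  · exact huniq μ hμ _ (hw'.mapsTo hμ) (hw'.stationary μ hμ).deriv
  · exact ((hs μ hμ _ (hwmem μ hμ)).comp (w μ) (f := fun ω => (μ, ω)) (by fun_prop)).of_le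
      (by norm_num)
  · exact lt_of_strictAntiOn_deriv (convex_closedBall ωs b) (hwmem μ hμ) (hdiff μ hμ)
      (hanti μ hμ) (hw0 μ hμ)
  · exact huniq μ hμ ω hω h.deriv

theorem eventually_forall_dist_lt {X Y Z : Type*} [TopologicalSpace X] [TopologicalSpace Y]
    [PseudoMetricSpace Z] {f : X × Y → Z} {K : Set Y} (hK : IsCompact K) {x : X}
    (hf : ∀ y ∈ K, ContinuousAt f (x, y)) {ε : ℝ} (hε : 0 < ε) :
    ∀ᶠ x' in 𝓝 x, ∀ y ∈ K, dist (f (x', y)) (f (x, y)) < ε := by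
  refine hK.eventually_forall_of_forall_eventually fun y hy => ?_
  have hconst : ContinuousAt (fun z : X × Y => f (x, z.2)) (x, y) :=
    ContinuousAt.comp (x := (x, y)) (f := fun z : X × Y => (x, z.2)) (hf y hy) (by fun_prop)
  exact ((hf y hy).dist hconst).eventually_lt continuousAt_const (by simpa using hε)

variable {Q X : Type*} [NormedAddCommGroup Q] [NormedSpace ℝ Q] [NormedAddCommGroup X]
  [NormedSpace ℝ X]

theorem exists_box_contDiffAt_deriv_deriv_lt (F : Q → X → ℝ → ℝ) {P : Set Q} (hP : IsCompact P)
    {x : X} {t c : ℝ} (hF : ∀ q ∈ P, ContDiffAt ℝ 4 (uncurry (uncurry F)) ((q, x), t))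
    (hF2 : ∀ q ∈ P, deriv (deriv (F q x)) t < c) :
    ∃ r > 0, ∀ x' ∈ closedBall x r, ∀ t' ∈ closedBall t r, ∀ q ∈ P,
      ContDiffAt ℝ 4 (uncurry (uncurry F)) ((q, x'), t') ∧ deriv (deriv (F q x')) t' < c := by
  have hev : ∀ᶠ y : X × ℝ in 𝓝 (x, t), ∀ q ∈ P,
      ContDiffAt ℝ 4 (uncurry (uncurry F)) ((q, y.1), y.2) ∧
        deriv (deriv (F q y.1)) y.2 < c := by
    refine hP.eventually_forall_of_forall_eventually fun q hq => ?_
    have hcont : ContinuousAt (fun y : (X × ℝ) × Q => ((y.2, y.1.1), y.1.2)) ((x, t), q) := by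
      fun_prop
    have hF1 : ContDiffAt ℝ 3 (fun z : (Q × X) × ℝ => deriv (F z.1.1 z.1.2) z.2) ((q, x), t) :=
      contDiffAt_deriv_snd (n := 3) (F := uncurry (uncurry F))
        (by convert hF q hq using 1; norm_num)
    have hF2' : ContDiffAt ℝ 2 (fun z : (Q × X) × ℝ => deriv (deriv (F z.1.1 z.1.2)) z.2)
        ((q, x), t) :=
      contDiffAt_deriv_snd (n := 2) (by convert hF1 using 1; norm_num)
    exact hcont.eventually (((hF q hq).eventually (by decide)).and
      (hF2'.continuousAt.eventually_lt continuousAt_const (hF2 q hq)))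
  obtain ⟨r, hr, hbox⟩ := nhds_basis_closedBall.eventually_iff.1 hev
  refine ⟨r, hr, fun x' hx' t' ht' => hbox (x := (x', t')) ?_⟩
  exact closedBall_prod_same x t r ▸ mk_mem_prod hx' ht'

theorem eventually_forall_deriv_dist_lt (F : Q → X → ℝ → ℝ) {P : Set Q} (hP : IsCompact P)
    {x : X} {t b : ℝ} (hF : ∀ q ∈ P, ∀ t' ∈ closedBall t b,
      ContDiffAt ℝ 4 (uncurry (uncurry F)) ((q, x), t')) {ε : ℝ} (hε : 0 < ε) :
    ∀ᶠ x' in 𝓝 x, ∀ q ∈ P, ∀ t' ∈ closedBall t b,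
      dist (deriv (F q x') t') (deriv (F q x) t') < ε := by
  have hcont : ∀ y ∈ P ×ˢ closedBall t b,
      ContinuousAt (fun z : X × Q × ℝ => deriv (F z.2.1 z.1) z.2.2) (x, y) := fun y hy =>
    (contDiffAt_deriv_snd (n := 3) (F := uncurry (uncurry F))
      (by convert hF y.1 hy.1 y.2 hy.2 using 1; norm_num)).continuousAt.comp
      (x := (x, y)) (f := fun z : X × Q × ℝ => ((z.2.1, z.1), z.2.2)) (by fun_prop)
  filter_upwards [eventually_forall_dist_lt (hP.prod (isCompact_closedBall t b)) hcont hε]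
    with x' hx' q hq t' ht' using hx' (q, t') ⟨hq, ht'⟩

theorem eventually_exists_isConcaveBranch {d : ℕ} (F : Q → EuclideanSpace ℝ (Fin d) → ℝ → ℝ)
    {P : Set Q} (hP : IsCompact P) {μs : EuclideanSpace ℝ (Fin d)} {ωs δ : ℝ} (hδ : δ < 0)
    (hF : ∀ q ∈ P, ContDiffAt ℝ 4 (uncurry (uncurry F)) ((q, μs), ωs))
    (hF2 : ∀ q ∈ P, deriv (deriv (F q μs)) ωs ≤ δ) :
    ∀ᶠ b in 𝓝[>] (0 : ℝ), ∀ᶠ a in 𝓝[>] (0 : ℝ), ∀ q ∈ P, ∀ μ₀ ∈ closedBall μs a,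
      ∀ ω₀ ∈ closedBall ωs (b / 2), HasDerivAt (F q μ₀) 0 ω₀ →
        ∃ w, IsConcaveBranch (F q) μs ωs a b (δ / 2) μ₀ ω₀ w := by
  obtain ⟨r, hr, hbox⟩ := exists_box_contDiffAt_deriv_deriv_lt F hP hF
    (c := δ / 2) fun q hq => (hF2 q hq).trans_lt (by linarith)
  filter_upwards [mem_nhdsWithin_of_mem_nhds (Iic_mem_nhds hr), self_mem_nhdsWithin] with b hbr hb
  rw [mem_Ioi] at hb
  have hsubω : closedBall ωs b ⊆ closedBall ωs r := closedBall_subset_closedBall hbr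
  have hvar := eventually_forall_deriv_dist_lt F hP (t := ωs) (b := b)
    (fun q hq t ht => (hbox μs (mem_closedBall_self hr.le) t (hsubω ht) q hq).1)
    (ε := -δ * b / 8) (by nlinarith)
  obtain ⟨r', hr', hvar⟩ := nhds_basis_closedBall.eventually_iff.1 hvar
  filter_upwards [mem_nhdsWithin_of_mem_nhds (Iic_mem_nhds hr),
    mem_nhdsWithin_of_mem_nhds (Iic_mem_nhds hr')] with a har har' q hq μ₀ hμ₀ ω₀ hω₀ h₀
  have hbox' : ∀ μ ∈ closedBall μs a, ∀ ω ∈ closedBall ωs b,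
      ContDiffAt ℝ 4 (uncurry (uncurry F)) ((q, μ), ω) ∧ deriv (deriv (F q μ)) ω < δ / 2 :=
    fun μ hμ ω hω => hbox μ (closedBall_subset_closedBall har hμ) ω (hsubω hω) q hq
  have hdiff : ∀ ω ∈ closedBall ωs b, DifferentiableAt ℝ (deriv (F q μ₀)) ω := fun ω hω =>
    (differentiableAt_of_deriv_ne_zero ((hbox' μ₀ hμ₀ ω hω).2.trans (by linarith)).ne)
  have hends := endpoint_bounds_of_deriv_le (by linarith) hdiff
    (fun ω hω => (hbox' μ₀ hμ₀ ω hω).2.le) hω₀ h₀.deriv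
  have hclose : ∀ μ ∈ closedBall μs a, ∀ ω ∈ closedBall ωs b,
      |deriv (F q μ) ω - deriv (F q μ₀) ω| < -δ * b / 4 := fun μ hμ ω hω => by
    have h₁ := hvar (closedBall_subset_closedBall har' hμ) q hq ω hω
    have h₂ := hvar (closedBall_subset_closedBall har' hμ₀) q hq ω hω
    linarith [dist_triangle_right (deriv (F q μ) ω) (deriv (F q μ₀) ω) (deriv (F q μs) ω),
      Real.dist_eq (deriv (F q μ) ω) (deriv (F q μ₀) ω)]
  refine exists_isConcaveBranch (by linarith)
    (fun μ hμ ω hω => (hbox' μ hμ ω hω).1.comp (f := fun z : _ × ℝ => ((q, z.1), z.2)) (μ, ω)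
      (by fun_prop)) (fun μ hμ ω hω => (hbox' μ hμ ω hω).2.le) (fun μ hμ => ?_) (fun μ hμ => ?_)
    hμ₀ (closedBall_subset_closedBall (by linarith) hω₀) h₀
  · have := hclose μ hμ (ωs - b) (by simp [abs_of_pos hb])
    linarith [(abs_lt.1 this).1, hends.1]
  · have := hclose μ hμ (ωs + b) (by simp [abs_of_pos hb])
    linarith [(abs_lt.1 this).2, hends.2]

end Branch

/-! ### Singular values -/

section SingularValues

open LinearMap Module

variable {𝕜 E F : Type*} [RCLike 𝕜] [NormedAddCommGroup E] [InnerProductSpace 𝕜 E]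
  [FiniteDimensional 𝕜 E] [NormedAddCommGroup F] [InnerProductSpace 𝕜 F] [FiniteDimensional 𝕜 F]

theorem norm_apply_sq_eq_sum (T : E →ₗ[𝕜] F) {n : ℕ} (hn : finrank 𝕜 E = n) (x : E) :
    ‖T x‖ ^ 2 = ∑ i : Fin n, T.singularValues i ^ 2 *
      ‖inner 𝕜 (T.isSymmetric_adjoint_comp_self.eigenvectorBasis hn i) x‖ ^ 2 := by
  set b := T.isSymmetric_adjoint_comp_self.eigenvectorBasis hn with hb
  have hcoord (i : Fin n) : inner 𝕜 (b i) ((adjoint T ∘ₗ T) x) =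
      ((T.singularValues i ^ 2 : ℝ) : 𝕜) * inner 𝕜 (b i) x := by
    rw [← T.isSymmetric_adjoint_comp_self, hb,
      T.isSymmetric_adjoint_comp_self.apply_eigenvectorBasis hn, inner_smul_left,
      T.sq_singularValues_fin hn, RCLike.conj_ofReal]
  have hterm (i : Fin n) : inner 𝕜 x (b i) * inner 𝕜 (b i) ((adjoint T ∘ₗ T) x) =
      ((T.singularValues i ^ 2 * ‖inner 𝕜 (b i) x‖ ^ 2 : ℝ) : 𝕜) := by
    rw [hcoord, ← inner_conj_symm x (b i), mul_left_comm, RCLike.conj_mul]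
    norm_cast
  have hsum : ((‖T x‖ ^ 2 : ℝ) : 𝕜) = inner 𝕜 x ((adjoint T ∘ₗ T) x) := by
    rw [comp_apply, adjoint_inner_right, inner_self_eq_norm_sq_to_K]
    norm_cast
  rw [← b.sum_inner_mul_inner, Finset.sum_congr rfl fun i _ => hterm i] at hsum
  exact_mod_cast hsum

theorem norm_apply_le_of_inner_eq_zero (T : E →ₗ[𝕜] F) {n : ℕ} (hn : finrank 𝕜 E = n)
    (k : ℕ) (x : E) (hx : ∀ i : Fin n, (i : ℕ) < k →
      inner 𝕜 (T.isSymmetric_adjoint_comp_self.eigenvectorBasis hn i) x = 0) :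
    ‖T x‖ ≤ T.singularValues k * ‖x‖ := by
  refine le_of_sq_le_sq ?_ (mul_nonneg (T.singularValues_nonneg k) (norm_nonneg _))
  rw [norm_apply_sq_eq_sum T hn, mul_pow,
    ← (T.isSymmetric_adjoint_comp_self.eigenvectorBasis hn).sum_sq_norm_inner_right x,
    Finset.mul_sum]
  refine Finset.sum_le_sum fun i _ => ?_
  rcases lt_or_ge (i : ℕ) k with h | h
  · simp [hx i h]
  · have := T.singularValues_antitone h
    have := T.singularValues_nonneg i
    gcongr

theorem le_norm_apply_of_inner_eq_zero (T : E →ₗ[𝕜] F) {n : ℕ} (hn : finrank 𝕜 E = n)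
    (k : ℕ) (x : E) (hx : ∀ i : Fin n, k < (i : ℕ) →
      inner 𝕜 (T.isSymmetric_adjoint_comp_self.eigenvectorBasis hn i) x = 0) :
    T.singularValues k * ‖x‖ ≤ ‖T x‖ := by
  refine le_of_sq_le_sq ?_ (norm_nonneg _)
  rw [norm_apply_sq_eq_sum T hn, mul_pow,
    ← (T.isSymmetric_adjoint_comp_self.eigenvectorBasis hn).sum_sq_norm_inner_right x,
    Finset.mul_sum]
  refine Finset.sum_le_sum fun i _ => ?_
  rcases lt_or_ge k (i : ℕ) with h | h
  · simp [hx i h]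
  · have := T.singularValues_antitone h
    have := T.singularValues_nonneg k
    gcongr

theorem exists_ne_zero_inner_eq_zero {n k : ℕ} (hk : k < n) (b b' : OrthonormalBasis (Fin n) 𝕜 E) :
    ∃ x ≠ 0, (∀ i : Fin n, k < (i : ℕ) → inner 𝕜 (b i) x = 0) ∧
      ∀ i : Fin n, (i : ℕ) < k → inner 𝕜 (b' i) x = 0 := by
  let Ψ : E →ₗ[𝕜] ({i : Fin n // i ≠ ⟨k, hk⟩} → 𝕜) :=
    LinearMap.pi fun i => innerₛₗ 𝕜 (if k < (i : Fin n) then b i else b' i)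
  have hdim : finrank 𝕜 ({i : Fin n // i ≠ ⟨k, hk⟩} → 𝕜) < finrank 𝕜 E := by
    rw [finrank_eq_card_basis b.toBasis, Fintype.card_fin, finrank_fintype_fun_eq_card,
      Fintype.card_subtype_compl, Fintype.card_subtype_eq, Fintype.card_fin]
    omega
  obtain ⟨x, hx, hx0⟩ := (Submodule.ne_bot_iff _).1 (ker_ne_bot_of_finrank_lt (f := Ψ) hdim)
  have hΨ (i : Fin n) (hi : (i : ℕ) ≠ k) :
      inner 𝕜 (if k < (i : ℕ) then b i else b' i) x = 0 :=
    congrFun (mem_ker.1 hx) ⟨i, fun h => hi (congrArg Fin.val h)⟩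
  refine ⟨x, hx0, fun i hi => ?_, fun i hi => ?_⟩
  · simpa only [if_pos hi] using hΨ i hi.ne'
  · simpa only [if_neg hi.not_gt] using hΨ i hi.ne

theorem singularValues_le_singularValues_add_norm (S T : E →L[𝕜] F) (k : ℕ) :
    (S : E →ₗ[𝕜] F).singularValues k ≤ (T : E →ₗ[𝕜] F).singularValues k + ‖S - T‖ := by
  rcases le_or_gt (finrank 𝕜 E) k with hk | hk
  · rw [singularValues_of_finrank_le _ hk]
    exact add_nonneg (singularValues_nonneg _ k) (norm_nonneg _)
  obtain ⟨x, hx0, hxS, hxT⟩ := exists_ne_zero_inner_eq_zero hk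
    ((S : E →ₗ[𝕜] F).isSymmetric_adjoint_comp_self.eigenvectorBasis rfl)
    ((T : E →ₗ[𝕜] F).isSymmetric_adjoint_comp_self.eigenvectorBasis rfl)
  refine le_of_mul_le_mul_right ?_ (norm_pos_iff.2 hx0)
  calc (S : E →ₗ[𝕜] F).singularValues k * ‖x‖
      ≤ ‖S x‖ := le_norm_apply_of_inner_eq_zero _ rfl k x hxS
    _ ≤ ‖T x‖ + ‖(S - T) x‖ := by
      simpa only [_root_.sub_apply, add_sub_cancel] using
        norm_add_le (T x) ((S - T) x)
    _ ≤ (T : E →ₗ[𝕜] F).singularValues k * ‖x‖ + ‖S - T‖ * ‖x‖ :=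
      add_le_add (norm_apply_le_of_inner_eq_zero _ rfl k x hxT) ((S - T).le_opNorm x)
    _ = _ := (add_mul _ _ _).symm

theorem continuous_singularValues (k : ℕ) :
    Continuous fun T : E →L[𝕜] F => (T : E →ₗ[𝕜] F).singularValues k := by
  refine (LipschitzWith.of_dist_le_mul (K := 1) fun S T => ?_).continuous
  rw [Real.dist_eq, dist_eq_norm, NNReal.coe_one, one_mul, abs_sub_le_iff]
  exact ⟨sub_le_iff_le_add'.2 (singularValues_le_singularValues_add_norm S T k),
    sub_le_iff_le_add'.2 (norm_sub_rev S T ▸ singularValues_le_singularValues_add_norm T S k)⟩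

theorem exists_singular_vectors (T : E →ₗ[𝕜] F) {k : ℕ} (hk : 0 < T.singularValues k) :
    ∃ u v, ‖u‖ = 1 ∧ ‖v‖ = 1 ∧ T v = (T.singularValues k : 𝕜) • u ∧
      adjoint T u = (T.singularValues k : 𝕜) • v := by
  have hkn : k < finrank 𝕜 E := by
    contrapose! hk
    exact (T.singularValues_of_finrank_le hk).le
  have hσ : (T.singularValues k : 𝕜) ≠ 0 := RCLike.ofReal_ne_zero.2 hk.ne'
  obtain ⟨x, hx⟩ := (T.hasEigenvalue_adjoint_comp_self_sq_singularValues hkn).exists_hasEigenvector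
  set v : E := ((‖x‖ : ℝ) : 𝕜)⁻¹ • x with hv_def
  have hv : ‖v‖ = 1 := norm_smul_inv_norm hx.2
  have hTv : adjoint T (T v) = (T.singularValues k : 𝕜) ^ 2 • v := by
    have hTx : adjoint T (T x) = (T.singularValues k : 𝕜) ^ 2 • x := hx.apply_eq_smul
    rw [hv_def, map_smul, map_smul, hTx, smul_comm]
  set u : F := (T.singularValues k : 𝕜)⁻¹ • T v with hu_def
  have hTu : adjoint T u = (T.singularValues k : 𝕜) • v := by
    rw [hu_def, map_smul, hTv, smul_smul, pow_two, inv_mul_cancel_left₀ hσ]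
  refine ⟨u, v, ?_, hv, (smul_inv_smul₀ hσ _).symm, hTu⟩
  have huu : inner 𝕜 u u = (1 : 𝕜) := by
    conv_lhs => rw [hu_def, inner_smul_right, ← adjoint_inner_left, hTu, inner_smul_left,
      RCLike.conj_ofReal, inner_self_eq_norm_sq_to_K, hv]
    simp [hσ]
  rw [inner_self_eq_norm_sq_to_K] at huu
  exact (pow_eq_one_iff_of_nonneg (norm_nonneg u) two_ne_zero).1 (by exact_mod_cast huu)

theorem singularValues_zero_eq_norm (T : E →L[𝕜] F) : (T : E →ₗ[𝕜] F).singularValues 0 = ‖T‖ := by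
  apply le_antisymm
  · rcases (singularValues_nonneg (T : E →ₗ[𝕜] F) 0).eq_or_lt with h | h
    · exact h ▸ norm_nonneg T
    · obtain ⟨u, v, hu, hv, hTv, -⟩ := exists_singular_vectors _ h
      have := T.le_opNorm v
      rwa [hv, mul_one, ← ContinuousLinearMap.coe_coe, hTv, norm_smul, hu, mul_one,
        RCLike.norm_of_nonneg h.le] at this
  · exact T.opNorm_le_bound (singularValues_nonneg _ 0)
      fun x => norm_apply_le_of_inner_eq_zero _ rfl 0 x fun i hi => absurd hi (Nat.not_lt_zero _)

end SingularValues

section MatrixSingularValues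

variable {p m : ℕ}

/-- The operator between Euclidean spaces that a matrix defines, as a continuous linear function
of the matrix. -/
noncomputable def euclideanOp : Matrix (Fin p) (Fin m) ℂ →L[ℂ]
    EuclideanSpace ℂ (Fin m) →L[ℂ] EuclideanSpace ℂ (Fin p) :=
  LinearMap.toContinuousLinearMap
    (Matrix.toEuclideanLin ≪≫ₗ LinearMap.toContinuousLinearMap).toLinearMap

theorem svalMax_eq_norm (M : Matrix (Fin p) (Fin m) ℂ) : svalMax M = ‖euclideanOp M‖ :=
  singularValues_zero_eq_norm (euclideanOp M)

theorem sval_nonneg (M : Matrix (Fin p) (Fin m) ℂ) (k : ℕ) : 0 ≤ sval M k :=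
  LinearMap.singularValues_nonneg _ _

theorem continuous_sval (k : ℕ) : Continuous fun M : Matrix (Fin p) (Fin m) ℂ => sval M k := by
  have hsval (M : Matrix (Fin p) (Fin m) ℂ) :
      sval M k = (euclideanOp M).toLinearMap.singularValues k := rfl
  simp only [hsval]
  exact (continuous_singularValues k).comp euclideanOp.continuous

theorem continuous_svalMax : Continuous (svalMax : Matrix (Fin p) (Fin m) ℂ → ℝ) :=
  continuous_sval 0

theorem continuous_svalSecond : Continuous (svalSecond : Matrix (Fin p) (Fin m) ℂ → ℝ) :=
  continuous_sval 1

theorem continuous_svalMin : Continuous (svalMin : Matrix (Fin p) (Fin p) ℂ → ℝ) :=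
  continuous_sval (p - 1)

theorem det_ne_zero_of_svalMin_pos {M : Matrix (Fin p) (Fin p) ℂ} (hM : 0 < svalMin M) :
    M.det ≠ 0 := by
  have hinj : Function.Injective (Matrix.toEuclideanLin M) := by
    rw [LinearMap.injective_iff_forall_lt_finrank_singularValues_pos]
    intro i hi
    rw [finrank_euclideanSpace_fin] at hi
    exact hM.trans_le ((Matrix.toEuclideanLin M).singularValues_antitone (by lia))
  intro hdet
  obtain ⟨v, hv, hMv⟩ := Matrix.exists_mulVec_eq_zero_iff.2 hdet
  refine hv (congrArg WithLp.ofLp ((injective_iff_map_eq_zero _).1 hinj (WithLp.toLp 2 v) ?_))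
  rw [Matrix.toLpLin_toLp, Matrix.toLin'_apply, hMv, WithLp.toLp_zero]

theorem exists_unit_singular_vectors {M : Matrix (Fin p) (Fin m) ℂ} (hM : 0 < svalMax M) :
    ∃ (u : Fin p → ℂ) (v : Fin m → ℂ), star u ⬝ᵥ u = 1 ∧ ‖WithLp.toLp 2 u‖ = 1 ∧
      ‖WithLp.toLp 2 v‖ = 1 ∧ M *ᵥ v = (svalMax M : ℂ) • u ∧ Mᴴ *ᵥ u = (svalMax M : ℂ) • v := by
  obtain ⟨u, v, hu, hv, hMv, hMu⟩ := exists_singular_vectors (Matrix.toEuclideanLin M) hM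
  rw [← Matrix.toEuclideanLin_conjTranspose_eq_adjoint] at hMu
  refine ⟨u.ofLp, v.ofLp, ?_, hu, hv, congrArg WithLp.ofLp hMv, congrArg WithLp.ofLp hMu⟩
  rw [dotProduct_comm, ← EuclideanSpace.inner_eq_star_dotProduct, inner_self_eq_norm_sq_to_K, hu]
  simp

theorem norm_star_dotProduct_mulVec_le (M : Matrix (Fin p) (Fin m) ℂ) (u : Fin p → ℂ)
    (v : Fin m → ℂ) :
    ‖star u ⬝ᵥ (M *ᵥ v)‖ ≤ svalMax M * ‖WithLp.toLp 2 u‖ * ‖WithLp.toLp 2 v‖ := by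
  have hinner : star u ⬝ᵥ (M *ᵥ v) =
      inner ℂ (WithLp.toLp 2 u) (euclideanOp M (WithLp.toLp 2 v)) := by
    rw [EuclideanSpace.inner_eq_star_dotProduct, dotProduct_comm]
    rfl
  calc ‖star u ⬝ᵥ (M *ᵥ v)‖
      ≤ ‖WithLp.toLp 2 u‖ * ‖euclideanOp M (WithLp.toLp 2 v)‖ := hinner ▸ norm_inner_le_norm _ _
    _ ≤ ‖WithLp.toLp 2 u‖ * (svalMax M * ‖WithLp.toLp 2 v‖) := by
      rw [svalMax_eq_norm]
      gcongr
      exact ContinuousLinearMap.le_opNorm _ _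
    _ = _ := by ring

theorem norm_apply_le_svalMax (M : Matrix (Fin p) (Fin m) ℂ) (i : Fin p) (j : Fin m) :
    ‖M i j‖ ≤ svalMax M := by
  have hentry : star (Pi.single i (1 : ℂ) : Fin p → ℂ) ⬝ᵥ (M *ᵥ Pi.single j 1) = M i j := by
    rw [← Pi.single_star, star_one, Matrix.mulVec_single_one, single_one_dotProduct, Matrix.col]
    rfl
  simpa [hentry] using norm_star_dotProduct_mulVec_le M (Pi.single i 1) (Pi.single j 1)

theorem det_smul_one_sub_eq_prod (M : Matrix (Fin p) (Fin m) ℂ) (t : ℝ) :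
    ((t : ℂ) • (1 : Matrix (Fin m) (Fin m) ℂ) - Mᴴ * M).det =
      ((∏ i : Fin m, (t - sval M i ^ 2) : ℝ) : ℂ) := by
  set T := Matrix.toEuclideanLin M with hT
  have hn : Module.finrank ℂ (EuclideanSpace ℂ (Fin m)) = m := finrank_euclideanSpace_fin
  have hgram : LinearMap.adjoint T ∘ₗ T = Matrix.toEuclideanLin (Mᴴ * M) := by
    rw [hT, ← Matrix.toEuclideanLin_conjTranspose_eq_adjoint]
    ext x : 1
    simp [Matrix.toEuclideanLin]
  have hcharpoly : (Mᴴ * M).charpoly = (LinearMap.adjoint T ∘ₗ T).charpoly := by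
    rw [hgram, Matrix.toEuclideanLin_eq_toLin_orthonormal, Matrix.charpoly_toLin]
  rw [Matrix.smul_one_eq_diagonal, ← Matrix.scalar_apply, ← Matrix.eval_charpoly, hcharpoly,
    T.isSymmetric_adjoint_comp_self.charpoly_eq hn, Polynomial.eval_prod, Complex.ofReal_prod]
  refine Finset.prod_congr rfl fun i _ => ?_
  rw [sval, T.sq_singularValues_fin hn i]
  simp

end MatrixSingularValues

section Smoothness

attribute [local instance] Matrix.normedAddCommGroup Matrix.normedSpace

variable {X : Type*} [NormedAddCommGroup X] [NormedSpace ℝ X] {n : WithTop ℕ∞} {x : X} {a b c : ℕ}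

theorem contDiffAt_matrix {f : X → Matrix (Fin a) (Fin b) ℂ} :
    ContDiffAt ℝ n f x ↔ ∀ i j, ContDiffAt ℝ n (fun y => f y i j) x :=
  (contDiffAt_pi (Φ := fun y => (f y : Fin a → Fin b → ℂ))).trans
    (forall_congr' fun i => contDiffAt_pi (Φ := fun y => (f y i : Fin b → ℂ)))

theorem contDiffAt_matrix_mul {f : X → Matrix (Fin a) (Fin b) ℂ}
    {g : X → Matrix (Fin b) (Fin c) ℂ} (hf : ContDiffAt ℝ n f x) (hg : ContDiffAt ℝ n g x) :
    ContDiffAt ℝ n (fun y => f y * g y) x := by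
  rw [contDiffAt_matrix] at *
  intro i j
  simp only [Matrix.mul_apply]
  exact ContDiffAt.sum fun k _ => (hf i k).mul (hg k j)

theorem contDiffAt_conjTranspose {f : X → Matrix (Fin a) (Fin b) ℂ} (hf : ContDiffAt ℝ n f x) :
    ContDiffAt ℝ n (fun y => (f y)ᴴ) x := by
  rw [contDiffAt_matrix] at *
  exact fun i j => Complex.conjCLE.contDiff.contDiffAt.comp x (hf j i)

theorem contDiffAt_det {f : X → Matrix (Fin a) (Fin a) ℂ} (hf : ContDiffAt ℝ n f x) :
    ContDiffAt ℝ n (fun y => (f y).det) x := by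
  rw [contDiffAt_matrix] at hf
  simp only [Matrix.det_apply]
  exact ContDiffAt.sum fun σ _ => (contDiffAt_prod fun i _ => hf (σ i) i).const_smul _

theorem contDiffAt_matrix_inv {f : X → Matrix (Fin a) (Fin a) ℂ} (hf : ContDiffAt ℝ n f x)
    (hx : (f x).det ≠ 0) : ContDiffAt ℝ n (fun y => (f y)⁻¹) x := by
  rw [contDiffAt_matrix]
  intro i j
  simp only [Matrix.inv_def, Ring.inverse_eq_inv', Matrix.smul_apply, smul_eq_mul,
    Matrix.adjugate_apply]
  refine ((contDiffAt_det hf).inv hx).mul (contDiffAt_det (contDiffAt_matrix.2 fun k l => ?_))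
  obtain rfl | hk := eq_or_ne k j
  · simpa only [Matrix.updateRow_self] using contDiffAt_const
  · simpa only [Matrix.updateRow_ne hk] using contDiffAt_matrix.1 hf k l

theorem deriv_prod_sub_ne_zero {ι : Type*} {s : Finset ι} (r : ι → ℝ) {i : ι} (hi : i ∈ s)
    (hr : ∀ j ∈ s, j ≠ i → r j ≠ r i) : deriv (fun t => ∏ j ∈ s, (t - r j)) (r i) ≠ 0 := by
  classical
  have hd : HasDerivAt (fun t => ∏ j ∈ s, (t - r j)) (∏ j ∈ s.erase i, (r i - r j)) (r i) := by
    refine (HasDerivAt.fun_finsetProd fun j _ =>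
      (hasDerivAt_id' (r i)).sub_const (r j)).congr_deriv ?_
    rw [Finset.sum_eq_single_of_mem i hi fun j _ hj => ?_, smul_eq_mul, mul_one]
    rw [Finset.prod_eq_zero (Finset.mem_erase.2 ⟨hj.symm, hi⟩) (sub_self _), zero_smul]
  rw [hd.deriv, Finset.prod_ne_zero_iff]
  exact fun j hj =>
    sub_ne_zero.2 (hr j (Finset.mem_of_mem_erase hj) (Finset.ne_of_mem_erase hj)).symm

theorem contDiffAt_prod_sub_sval_sq {p m : ℕ} (z : Matrix (Fin p) (Fin m) ℂ × ℝ) :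
    ContDiffAt ℝ n (fun y : Matrix (Fin p) (Fin m) ℂ × ℝ =>
      ∏ i : Fin m, (y.2 - sval y.1 i ^ 2)) z := by
  have ht : ContDiffAt ℝ n (fun y : Matrix (Fin p) (Fin m) ℂ × ℝ =>
      (y.2 : ℂ) • (1 : Matrix (Fin m) (Fin m) ℂ)) z :=
    (Complex.ofRealCLM.contDiff.contDiffAt.comp z contDiffAt_snd).smul contDiffAt_const
  have hM : ContDiffAt ℝ n (fun y : Matrix (Fin p) (Fin m) ℂ × ℝ => y.1ᴴ * y.1) z :=
    contDiffAt_matrix_mul (contDiffAt_conjTranspose contDiffAt_fst) contDiffAt_fst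
  exact (Complex.reCLM.contDiff.contDiffAt.comp z
    (contDiffAt_det (ht.sub hM))).congr_of_eventuallyEq <| Eventually.of_forall fun y =>
      (congrArg Complex.re (det_smul_one_sub_eq_prod y.1 y.2)).symm

theorem contDiffAt_svalMax_sq {p m : ℕ} {M : Matrix (Fin p) (Fin m) ℂ} (hn : n ≠ 0)
    (hM : svalSecond M < svalMax M) : ContDiffAt ℝ n (fun N => svalMax N ^ 2) M := by
  have hm : 0 < m := Nat.pos_of_ne_zero fun hm => ((sval_nonneg M 1).trans_lt hM).ne'
    ((Matrix.toEuclideanLin M).singularValues_of_finrank_le (by simp [hm]))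
  have hsecond (N : Matrix (Fin p) (Fin m) ℂ) (i : Fin m) (hi : i ≠ ⟨0, hm⟩) :
      sval N i ^ 2 ≤ svalSecond N ^ 2 :=
    pow_le_pow_left₀ (sval_nonneg N i) ((Matrix.toEuclideanLin N).singularValues_antitone
      (Nat.one_le_iff_ne_zero.2 fun h => hi (Fin.ext h))) 2
  have hlt : svalSecond M ^ 2 < svalMax M ^ 2 := pow_lt_pow_left₀ hM (sval_nonneg M 1) two_ne_zero
  obtain ⟨t₀, ht₀, ht₀'⟩ := exists_between hlt
  have hs : ∀ᶠ N : Matrix (Fin p) (Fin m) ℂ in 𝓝 M, svalSecond N ^ 2 < t₀ :=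
    (continuous_svalSecond.pow 2).continuousAt.eventually_lt_const ht₀
  have hmax (N : Matrix (Fin p) (Fin m) ℂ) : svalMax N = sval N (⟨0, hm⟩ : Fin m) := rfl
  have hne : deriv (fun t => ∏ i : Fin m, (t - sval M i ^ 2)) (svalMax M ^ 2) ≠ 0 := by
    rw [hmax]
    exact deriv_prod_sub_ne_zero (fun i : Fin m => sval M i ^ 2)
      (Finset.mem_univ (⟨0, hm⟩ : Fin m)) fun i _ hi => ((hsecond M i hi).trans_lt hlt).ne
  have hzero : ∏ i : Fin m, (svalMax M ^ 2 - sval M i ^ 2) = 0 :=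
    Finset.prod_eq_zero (Finset.mem_univ (⟨0, hm⟩ : Fin m)) (by rw [hmax, sub_self])
  -- `svalMax N ^ 2` is the only root of the characteristic polynomial of `Nᴴ * N` beyond `t₀`.
  have huniq : ∀ N ∈ {N : Matrix (Fin p) (Fin m) ℂ | svalSecond N ^ 2 < t₀}, ∀ t ∈ Ioi t₀,
      ∏ i : Fin m, (t - sval N i ^ 2) = 0 → t = svalMax N ^ 2 := by
    intro N (hN : svalSecond N ^ 2 < t₀) t ht hNt
    obtain ⟨i, -, hi⟩ := Finset.prod_eq_zero_iff.1 hNt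
    obtain rfl | hi0 := eq_or_ne i ⟨0, hm⟩
    · rw [hmax, sub_eq_zero.1 hi]
    · linarith [hsecond N i hi0, mem_Ioi.1 ht]
  have : CompleteSpace (Matrix (Fin p) (Fin m) ℂ) :=
    inferInstanceAs (CompleteSpace (Fin p → Fin m → ℂ))
  exact (contDiffWithinAt_of_unique_zero
    (F := fun y : Matrix (Fin p) (Fin m) ℂ × ℝ => ∏ i : Fin m, (y.2 - sval y.1 i ^ 2))
    (w := fun N => svalMax N ^ 2) hn (contDiffAt_prod_sub_sval_sq _) hne hzero
    (Ioi_mem_nhds ht₀') huniq).contDiffAt hs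

theorem contDiffAt_svalMax {p m : ℕ} {M : Matrix (Fin p) (Fin m) ℂ} (hn : n ≠ 0)
    (hM : svalSecond M < svalMax M) : ContDiffAt ℝ n svalMax M := by
  have hpos : 0 < svalMax M := (sval_nonneg M 1).trans_lt hM
  exact ((contDiffAt_svalMax_sq hn hM).sqrt (pow_pos hpos 2).ne').congr_of_eventuallyEq
    (Eventually.of_forall fun N => (Real.sqrt_sq (sval_nonneg N 0)).symm)

end Smoothness

section Transfer

open Polynomial

variable {r m p : ℕ}

theorem eval_algebraMap_div (a : ℂ[X]) {b : ℂ[X]} {s : ℂ} (hb : b.eval s ≠ 0) :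
    RatFunc.eval (RingHom.id ℂ) s
      (algebraMap ℂ[X] (RatFunc ℂ) a / algebraMap ℂ[X] (RatFunc ℂ) b) = a.eval s / b.eval s := by
  have hb0 : algebraMap ℂ[X] (RatFunc ℂ) b ≠ 0 :=
    RatFunc.algebraMap_ne_zero (by rintro rfl; exact hb eval_zero)
  have hden : (algebraMap ℂ[X] (RatFunc ℂ) a / algebraMap ℂ[X] (RatFunc ℂ) b).denom.eval s ≠ 0 :=
    fun h => hb (eval_eq_zero_of_dvd_of_eval_eq_zero (RatFunc.denom_div_dvd a b) h)
  have hmul := RatFunc.eval_mul (f := RingHom.id ℂ) (a := s)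
    (y := algebraMap ℂ[X] (RatFunc ℂ) b) hden (by simp)
  rw [eq_div_iff hb]
  simpa [div_mul_cancel₀ _ hb0, RatFunc.eval_algebraMap] using hmul.symm

/-- The pencil `s E - A` as a matrix of polynomials in `s`, through which the transfer function is
evaluated by Cramer's rule. -/
noncomputable def polyPencil (E A : Matrix (Fin r) (Fin r) ℂ) : Matrix (Fin r) (Fin r) ℂ[X] :=
  (X : ℂ[X]) • E.map Polynomial.C - A.map Polynomial.C

theorem map_polyPencil {R : Type*} [CommRing R] (φ : ℂ[X] →+* R) (E A : Matrix (Fin r) (Fin r) ℂ) :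
    (polyPencil E A).map φ =
      φ X • E.map (φ.comp Polynomial.C) - A.map (φ.comp Polynomial.C) := by
  ext i j
  simp only [polyPencil, Matrix.map_apply, Matrix.sub_apply, Matrix.smul_apply, smul_eq_mul,
    map_sub, map_mul, RingHom.comp_apply]

theorem mul_inv_map_mul {K : Type*} [Field K] (φ : ℂ[X] →+* K) (P : Matrix (Fin r) (Fin r) ℂ[X])
    (B : Matrix (Fin r) (Fin m) ℂ) (C : Matrix (Fin p) (Fin r) ℂ) :
    C.map (φ.comp Polynomial.C) * (P.map φ)⁻¹ * B.map (φ.comp Polynomial.C) =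
      (φ P.det)⁻¹ • (C.map Polynomial.C * P.adjugate * B.map Polynomial.C).map φ := by
  have hinv : (P.map φ)⁻¹ = (φ P.det)⁻¹ • P.adjugate.map φ := by
    rw [Matrix.inv_def, Ring.inverse_eq_inv', ← RingHom.mapMatrix_apply, ← RingHom.map_det,
      ← RingHom.map_adjugate, RingHom.mapMatrix_apply]
  rw [hinv, Matrix.mul_smul, Matrix.smul_mul, Matrix.map_mul, Matrix.map_mul, Matrix.map_map,
    Matrix.map_map]
  rfl

theorem evalAt_transfer (E A : Matrix (Fin r) (Fin r) ℂ) (B : Matrix (Fin r) (Fin m) ℂ)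
    (C : Matrix (Fin p) (Fin r) ℂ) {s : ℂ} (hs : (s • E - A).det ≠ 0) :
    evalAt (transfer E A B C) s = C * (s • E - A)⁻¹ * B := by
  have hC : RatFunc.C = (algebraMap ℂ[X] (RatFunc ℂ)).comp Polynomial.C := rfl
  have hid : (evalRingHom s).comp Polynomial.C = RingHom.id ℂ := by ext; simp
  have hP : (polyPencil E A).map (evalRingHom s) = s • E - A := by
    rw [map_polyPencil, hid, coe_evalRingHom, eval_X]
    simp
  have hdet : (polyPencil E A).det.eval s = (s • E - A).det := by
    rw [← hP, ← coe_evalRingHom, RingHom.map_det, RingHom.mapMatrix_apply]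
  have htransfer := mul_inv_map_mul (algebraMap ℂ[X] (RatFunc ℂ)) (polyPencil E A) B C
  rw [map_polyPencil, RatFunc.algebraMap_X, ← hC] at htransfer
  have hvalue := mul_inv_map_mul (evalRingHom s) (polyPencil E A) B C
  rw [hP, hid, coe_evalRingHom, hdet] at hvalue
  ext i j
  calc evalAt (transfer E A B C) s i j
      = RatFunc.eval (RingHom.id ℂ) s (algebraMap ℂ[X] (RatFunc ℂ)
          ((C.map Polynomial.C * (polyPencil E A).adjugate * B.map Polynomial.C) i j) /
          algebraMap ℂ[X] (RatFunc ℂ) (polyPencil E A).det) := by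
        rw [evalAt, transfer, htransfer, Matrix.map_apply, Matrix.smul_apply, smul_eq_mul,
          inv_mul_eq_div, Matrix.map_apply]
    _ = (C * (s • E - A)⁻¹ * B) i j := by
        rw [eval_algebraMap_div _ (hdet ▸ hs), hdet, ← inv_mul_eq_div]
        simpa using (congrFun (congrFun hvalue i) j).symm

end Transfer

/-! ### Reduced systems -/

theorem cplx_sum_smul {a b κ : ℕ} (c : Fin κ → ℝ) (M : Fin κ → Matrix (Fin a) (Fin b) ℝ) :
    cplx (∑ i, c i • M i) = ∑ i, (c i : ℂ) • cplx (M i) := by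
  ext i j
  simp [cplx, Matrix.sum_apply]

/-- Pairs `(V, W)` of matrices with the format of the projection matrices of a reduced system of
order `r`. -/
abbrev ProjectionPair (n r : ℕ) : Type :=
  Matrix (Fin n) (Fin r) ℂ × Matrix (Fin n) (Fin r) ℂ

namespace ParamSystem

variable {d n m p r : ℕ} (S : ParamSystem d n m p)

section Projection

variable (V W : Matrix (Fin n) (Fin r) ℂ) (μ : EuclideanSpace ℝ (Fin d)) (s : ℂ)

theorem redE_eq : S.redE V W μ = Wᴴ * cplx (S.E μ) * V := by
  simp [redE, E, cplx_sum_smul, Matrix.mul_sum, Matrix.sum_mul]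

theorem redA_eq : S.redA V W μ = Wᴴ * cplx (S.A μ) * V := by
  simp [redA, A, cplx_sum_smul, Matrix.mul_sum, Matrix.sum_mul]

theorem redB_eq : S.redB W μ = Wᴴ * cplx (S.B μ) := by
  simp [redB, B, cplx_sum_smul, Matrix.mul_sum]

theorem redC_eq : S.redC V μ = cplx (S.C μ) * V := by
  simp [redC, C, cplx_sum_smul, Matrix.sum_mul]

theorem redD_eq : S.redD V W μ s = Wᴴ * S.D μ s * V := by
  simp [redD, D, redE_eq, redA_eq, Matrix.mul_sub, Matrix.sub_mul]

theorem redD_one : S.redD (1 : Matrix (Fin n) (Fin n) ℂ) 1 μ s = S.D μ s := by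
  simp [redD_eq]

theorem redH_one : S.redH (1 : Matrix (Fin n) (Fin n) ℂ) 1 μ s = S.H μ s := by
  simp [redH, H, redE_eq, redA_eq, redB_eq, redC_eq]

theorem redSigma_one : S.redSigma (1 : Matrix (Fin n) (Fin n) ℂ) 1 = S.sigma := by
  funext μ ω
  rw [redSigma, sigma, redH_one]

theorem redSigmaSecond_one :
    S.redSigmaSecond (1 : Matrix (Fin n) (Fin n) ℂ) 1 = S.sigmaSecond := by
  funext μ ω
  rw [redSigmaSecond, sigmaSecond, redH_one]

variable {V W μ s}

theorem redH_of_det_ne_zero (h : (S.redD V W μ s).det ≠ 0) :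
    S.redH V W μ s = S.redC V μ * (S.redD V W μ s)⁻¹ * S.redB W μ :=
  evalAt_transfer _ _ _ _ h

theorem H_of_det_ne_zero (h : (S.D μ s).det ≠ 0) :
    S.H μ s = cplx (S.C μ) * (S.D μ s)⁻¹ * cplx (S.B μ) :=
  evalAt_transfer _ _ _ _ h

end Projection

section Regularity

attribute [local instance] Matrix.normedAddCommGroup Matrix.normedSpace

variable {X : Type*} [NormedAddCommGroup X] [NormedSpace ℝ X] {N : WithTop ℕ∞} {x : X}
  {μ : X → EuclideanSpace ℝ (Fin d)}

theorem contDiffAt_sum_smul {a b κ : ℕ} {c : Fin κ → EuclideanSpace ℝ (Fin d) → ℝ}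
    (hc : ∀ i, AnalyticAt ℝ (c i) (μ x)) (hμ : ContDiffAt ℝ N μ x)
    {M : Fin κ → X → Matrix (Fin a) (Fin b) ℂ} (hM : ∀ i, ContDiffAt ℝ N (M i) x) :
    ContDiffAt ℝ N (fun y => ∑ i, (c i (μ y) : ℂ) • M i y) x :=
  ContDiffAt.sum fun i _ => ContDiffAt.smul (f := fun y => (c i (μ y) : ℂ))
    (Complex.ofRealCLM.contDiff.contDiffAt.comp x ((hc i).contDiffAt.comp x hμ)) (hM i)

variable {V W : X → Matrix (Fin n) (Fin r) ℂ} {ω : X → ℝ}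

theorem contDiffAt_redD (hx : μ x ∈ S.Ω) (hV : ContDiffAt ℝ N V x) (hW : ContDiffAt ℝ N W x)
    (hμ : ContDiffAt ℝ N μ x) (hω : ContDiffAt ℝ N ω x) :
    ContDiffAt ℝ N (fun y => S.redD (V y) (W y) (μ y) (Complex.I * ω y)) x := by
  have hs : ContDiffAt ℝ N (fun y => Complex.I * (ω y : ℂ)) x :=
    contDiffAt_const.mul (Complex.ofRealCLM.contDiff.contDiffAt.comp x hω)
  have hWMV (M : Matrix (Fin n) (Fin n) ℝ) :
      ContDiffAt ℝ N (fun y => (W y)ᴴ * cplx M * V y) x :=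
    contDiffAt_matrix_mul (contDiffAt_matrix_mul (contDiffAt_conjTranspose hW) contDiffAt_const) hV
  exact (hs.smul (contDiffAt_sum_smul (fun i => S.analytic_f i _ hx) hμ fun i => hWMV _)).sub
    (contDiffAt_sum_smul (fun i => S.analytic_g i _ hx) hμ fun i => hWMV _)

theorem contDiffAt_redH (hx : μ x ∈ S.Ω)
    (hdet : (S.redD (V x) (W x) (μ x) (Complex.I * ω x)).det ≠ 0)
    (hV : ContDiffAt ℝ N V x) (hW : ContDiffAt ℝ N W x)
    (hμ : ContDiffAt ℝ N μ x) (hω : ContDiffAt ℝ N ω x) :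
    ContDiffAt ℝ N (fun y => S.redH (V y) (W y) (μ y) (Complex.I * ω y)) x := by
  have hB : ContDiffAt ℝ N (fun y => S.redB (W y) (μ y)) x :=
    contDiffAt_sum_smul (fun i => S.analytic_h i _ hx) hμ fun i =>
      contDiffAt_matrix_mul (contDiffAt_conjTranspose hW) contDiffAt_const
  have hC : ContDiffAt ℝ N (fun y => S.redC (V y) (μ y)) x :=
    contDiffAt_sum_smul (fun i => S.analytic_k i _ hx) hμ fun i =>
      contDiffAt_matrix_mul contDiffAt_const hV
  have hD := S.contDiffAt_redD hx hV hW hμ hω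
  refine (contDiffAt_matrix_mul (contDiffAt_matrix_mul hC
    (contDiffAt_matrix_inv hD hdet)) hB).congr_of_eventuallyEq ?_
  filter_upwards [(contDiffAt_det hD).continuousAt.eventually_ne hdet] with y hy
  exact S.redH_of_det_ne_zero hy

theorem contDiffAt_redSigma (hN : N ≠ 0) (hx : μ x ∈ S.Ω)
    (hdet : (S.redD (V x) (W x) (μ x) (Complex.I * ω x)).det ≠ 0)
    (hgap : S.redSigmaSecond (V x) (W x) (μ x) (ω x) < S.redSigma (V x) (W x) (μ x) (ω x))
    (hV : ContDiffAt ℝ N V x) (hW : ContDiffAt ℝ N W x)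
    (hμ : ContDiffAt ℝ N μ x) (hω : ContDiffAt ℝ N ω x) :
    ContDiffAt ℝ N (fun y => S.redSigma (V y) (W y) (μ y) (ω y)) x :=
  ContDiffAt.comp (g := svalMax) x (contDiffAt_svalMax hN hgap)
    (S.contDiffAt_redH hx hdet hV hW hμ hω)

theorem differentiableAt_redSigma {V W : Matrix (Fin n) (Fin r) ℂ}
    {μ : EuclideanSpace ℝ (Fin d)} {ω : ℝ} (hμ : μ ∈ S.Ω)
    (hdet : (S.redD V W μ (Complex.I * ω)).det ≠ 0)
    (hgap : S.redSigmaSecond V W μ ω < S.redSigma V W μ ω) :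
    DifferentiableAt ℝ (S.redSigma V W μ) ω :=
  (S.contDiffAt_redSigma (μ := fun _ => μ) (V := fun _ => V) (W := fun _ => W) (ω := id)
    one_ne_zero hμ hdet hgap contDiffAt_const contDiffAt_const contDiffAt_const
    contDiffAt_id).differentiableAt one_ne_zero

/-- The gap `σ₁ - σ₂` between the two largest singular values of `H^{V,W}[μ](iω)`, where
`q = (V, W)`. -/
noncomputable def redGap (q : ProjectionPair n r) (μ : EuclideanSpace ℝ (Fin d)) (ω : ℝ) : ℝ :=
  S.redSigma q.1 q.2 μ ω - S.redSigmaSecond q.1 q.2 μ ω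

theorem continuousAt_redGap {z : (ProjectionPair n r × EuclideanSpace ℝ (Fin d)) × ℝ}
    (hz : z.1.2 ∈ S.Ω) (hdet : (S.redD z.1.1.1 z.1.1.2 z.1.2 (Complex.I * z.2)).det ≠ 0) :
    ContinuousAt (fun y : (ProjectionPair n r × EuclideanSpace ℝ (Fin d)) × ℝ =>
      S.redGap y.1.1 y.1.2 y.2) z := by
  have hH : ContinuousAt (fun y : (ProjectionPair n r × EuclideanSpace ℝ (Fin d)) × ℝ =>
      S.redH y.1.1.1 y.1.1.2 y.1.2 (Complex.I * y.2)) z :=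
    ContDiffAt.continuousAt (𝕜 := ℝ) (n := 0) <| S.contDiffAt_redH hz hdet
      (contDiff_fst.fst.fst).contDiffAt (contDiff_fst.fst.snd).contDiffAt
      contDiff_fst.snd.contDiffAt contDiff_snd.contDiffAt
  have hσ := continuous_svalMax.continuousAt.comp hH
  have hσ₂ := continuous_svalSecond.continuousAt.comp hH
  exact hσ.sub hσ₂

end Regularity

end ParamSystem

/-! ### Interpolation -/

section

attribute [local instance] Matrix.linftyOpNormedRing Matrix.linftyOpNormedAlgebra

theorem hasDerivAt_matrix_inv {r : ℕ} {M : ℝ → Matrix (Fin r) (Fin r) ℂ}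
    {M' : Matrix (Fin r) (Fin r) ℂ} {t : ℝ} (hM : HasDerivAt M M' t) (hdet : (M t).det ≠ 0) :
    HasDerivAt (fun τ => (M τ)⁻¹) (-((M t)⁻¹ * M' * (M t)⁻¹)) t := by
  obtain ⟨u, hu⟩ := (Matrix.isUnit_iff_isUnit_det _).2 (isUnit_iff_ne_zero.2 hdet)
  have hinv := hasFDerivAt_ringInverse (𝕜 := ℝ) u
  rw [hu] at hinv
  have h := hinv.comp_hasDerivAt t hM
  simp only [Function.comp_def, ← Matrix.nonsing_inv_eq_ringInverse] at h
  have hu' : (M t)⁻¹ = ↑u⁻¹ := by rw [← hu, Matrix.coe_units_inv]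
  rw [hu']
  exact h

end

section

attribute [local instance] Matrix.normedAddCommGroup Matrix.normedSpace

theorem hasDerivAt_star_dotProduct_inv_mulVec {r : ℕ} {M : ℝ → Matrix (Fin r) (Fin r) ℂ}
    {M' : Matrix (Fin r) (Fin r) ℂ} {t : ℝ} (hM : HasDerivAt M M' t) (hdet : (M t).det ≠ 0)
    {a b x y : Fin r → ℂ} (hx : M t *ᵥ x = b) (hy : (M t)ᴴ *ᵥ y = a) :
    HasDerivAt (fun τ => star a ⬝ᵥ ((M τ)⁻¹ *ᵥ b)) (-(star y ⬝ᵥ (M' *ᵥ x))) t := by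
  let L : Matrix (Fin r) (Fin r) ℂ →ₗ[ℝ] ℂ :=
    { toFun := fun N => star a ⬝ᵥ (N *ᵥ b)
      map_add' := fun N N' => by rw [Matrix.add_mulVec, dotProduct_add]
      map_smul' := fun c N => by rw [Matrix.smul_mulVec, dotProduct_smul, RingHom.id_apply] }
  have hL : L ((M t)⁻¹ * M' * (M t)⁻¹) = star y ⬝ᵥ (M' *ᵥ x) := by
    have hunit := isUnit_iff_ne_zero.2 hdet
    change star a ⬝ᵥ (_ *ᵥ b) = _
    rw [← hx, ← hy, Matrix.star_mulVec, Matrix.conjTranspose_conjTranspose,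
      ← Matrix.dotProduct_mulVec, Matrix.mulVec_mulVec, Matrix.mulVec_mulVec,
      ← Matrix.mul_assoc, ← Matrix.mul_assoc, Matrix.mul_nonsing_inv _ hunit, Matrix.one_mul,
      Matrix.nonsing_inv_mul_cancel_right _ _ hunit]
  rw [← hL, ← map_neg]
  exact L.toContinuousLinearMap.hasFDerivAt.comp_hasDerivAt t (hasDerivAt_matrix_inv hM hdet)

end

theorem hasDerivAt_of_le_of_eq {φ s : ℝ → ℝ} {φ' t : ℝ} (hφ : HasDerivAt φ φ' t)
    (hs : DifferentiableAt ℝ s t) (hle : ∀ τ, φ τ ≤ s τ) (heq : φ t = s t) :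
    HasDerivAt s φ' t := by
  have hmin : IsLocalMin (s - φ) t := Eventually.of_forall fun τ => by
    simpa only [Pi.sub_apply, heq, sub_self, sub_nonneg] using hle τ
  have h0 := hmin.hasDerivAt_eq_zero (hs.hasDerivAt.sub hφ)
  exact sub_eq_zero.1 h0 ▸ hs.hasDerivAt

theorem exists_mulVec_eq_of_col_le {a b c : ℕ} {M : Matrix (Fin a) (Fin b) ℂ}
    {V : Matrix (Fin a) (Fin c) ℂ} (h : col M ≤ col V) (z : Fin b → ℂ) :
    ∃ x, V *ᵥ x = M *ᵥ z :=
  h ⟨z, rfl⟩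

namespace ParamSystem

variable {d n m p : ℕ} (S : ParamSystem d n m p) {r : ℕ} {V W : Matrix (Fin n) (Fin r) ℂ}
  {μ : EuclideanSpace ℝ (Fin d)} {ω : ℝ}

section

attribute [local instance] Matrix.normedAddCommGroup Matrix.normedSpace

theorem hasDerivAt_redD :
    HasDerivAt (fun t : ℝ => S.redD V W μ (Complex.I * t)) (Complex.I • S.redE V W μ) ω := by
  have h : HasDerivAt (fun t : ℝ => Complex.I * (t : ℂ)) Complex.I ω := by
    simpa using (Complex.ofRealCLM.hasDerivAt (x := ω)).const_mul Complex.I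
  exact (h.smul_const (S.redE V W μ)).sub_const (S.redA V W μ)

theorem hasDerivAt_pairing_redH (hDr : (S.redD V W μ (Complex.I * ω)).det ≠ 0)
    {u : Fin p → ℂ} {v : Fin m → ℂ} {x y : Fin r → ℂ}
    (hx : S.redD V W μ (Complex.I * ω) *ᵥ x = S.redB W μ *ᵥ v)
    (hy : (S.redD V W μ (Complex.I * ω))ᴴ *ᵥ y = (S.redC V μ)ᴴ *ᵥ u) :
    HasDerivAt (fun t : ℝ => star u ⬝ᵥ (S.redH V W μ (Complex.I * t) *ᵥ v))
      (-(star (W *ᵥ y) ⬝ᵥ ((Complex.I • cplx (S.E μ)) *ᵥ (V *ᵥ x)))) ω := by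
  have h := hasDerivAt_star_dotProduct_inv_mulVec S.hasDerivAt_redD hDr hx hy
  have hE : star y ⬝ᵥ ((Complex.I • S.redE V W μ) *ᵥ x) =
      star (W *ᵥ y) ⬝ᵥ ((Complex.I • cplx (S.E μ)) *ᵥ (V *ᵥ x)) := by
    rw [redE_eq, Matrix.star_mulVec, ← Matrix.dotProduct_mulVec]
    simp [Matrix.mul_assoc, Matrix.smul_mulVec, Matrix.mulVec_smul]
  rw [← hE]
  refine h.congr_of_eventuallyEq ?_
  filter_upwards [(continuous_id.matrix_det.continuousAt.comp
    S.hasDerivAt_redD.continuousAt).eventually_ne hDr] with t ht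
  rw [S.redH_of_det_ne_zero ht, Matrix.star_mulVec, Matrix.conjTranspose_conjTranspose,
    ← Matrix.dotProduct_mulVec, Matrix.mulVec_mulVec, Matrix.mulVec_mulVec, Matrix.mul_assoc]

end

theorem redD_mulVec_eq (hD : (S.D μ (Complex.I * ω)).det ≠ 0) {x : Fin r → ℂ} {v : Fin m → ℂ}
    (hx : V *ᵥ x = ((S.D μ (Complex.I * ω))⁻¹ * cplx (S.B μ)) *ᵥ v) :
    S.redD V W μ (Complex.I * ω) *ᵥ x = S.redB W μ *ᵥ v := by
  rw [redD_eq, redB_eq, ← Matrix.mulVec_mulVec, hx, Matrix.mulVec_mulVec, Matrix.mul_assoc,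
    Matrix.mul_nonsing_inv_cancel_left _ _ (isUnit_iff_ne_zero.2 hD)]

theorem conjTranspose_redD_mulVec_eq (hD : (S.D μ (Complex.I * ω)).det ≠ 0) {y : Fin r → ℂ}
    {u : Fin p → ℂ} (hy : W *ᵥ y = (((S.D μ (Complex.I * ω))⁻¹)ᴴ * (cplx (S.C μ))ᴴ) *ᵥ u) :
    (S.redD V W μ (Complex.I * ω))ᴴ *ᵥ y = (S.redC V μ)ᴴ *ᵥ u := by
  have hDC : (S.D μ (Complex.I * ω))ᴴ * (((S.D μ (Complex.I * ω))⁻¹)ᴴ * (cplx (S.C μ))ᴴ) =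
      (cplx (S.C μ))ᴴ := by
    rw [← Matrix.mul_assoc, ← Matrix.conjTranspose_mul,
      Matrix.nonsing_inv_mul _ (isUnit_iff_ne_zero.2 hD), Matrix.conjTranspose_one, Matrix.one_mul]
  rw [redD_eq, redC_eq, Matrix.conjTranspose_mul, Matrix.conjTranspose_mul,
    Matrix.conjTranspose_conjTranspose, ← Matrix.mulVec_mulVec, ← Matrix.mulVec_mulVec, hy,
    Matrix.mulVec_mulVec u, hDC, Matrix.mulVec_mulVec, Matrix.conjTranspose_mul]

theorem redH_mulVec_eq (hD : (S.D μ (Complex.I * ω)).det ≠ 0)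
    (hDr : (S.redD V W μ (Complex.I * ω)).det ≠ 0) {x : Fin r → ℂ} {v : Fin m → ℂ}
    (hx : V *ᵥ x = ((S.D μ (Complex.I * ω))⁻¹ * cplx (S.B μ)) *ᵥ v) :
    S.redH V W μ (Complex.I * ω) *ᵥ v = S.H μ (Complex.I * ω) *ᵥ v := by
  rw [S.redH_of_det_ne_zero hDr, S.H_of_det_ne_zero hD, ← Matrix.mulVec_mulVec,
    ← S.redD_mulVec_eq hD hx, Matrix.mulVec_mulVec,
    Matrix.nonsing_inv_mul_cancel_right _ _ (isUnit_iff_ne_zero.2 hDr), redC_eq,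
    ← Matrix.mulVec_mulVec, hx, Matrix.mulVec_mulVec, Matrix.mul_assoc]

theorem conjTranspose_redH_mulVec_eq (hD : (S.D μ (Complex.I * ω)).det ≠ 0)
    (hDr : (S.redD V W μ (Complex.I * ω)).det ≠ 0) {y : Fin r → ℂ} {u : Fin p → ℂ}
    (hy : W *ᵥ y = (((S.D μ (Complex.I * ω))⁻¹)ᴴ * (cplx (S.C μ))ᴴ) *ᵥ u) :
    (S.redH V W μ (Complex.I * ω))ᴴ *ᵥ u = (S.H μ (Complex.I * ω))ᴴ *ᵥ u := by
  have hinv : ((S.redD V W μ (Complex.I * ω))⁻¹)ᴴ * (S.redD V W μ (Complex.I * ω))ᴴ = 1 := by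
    rw [← Matrix.conjTranspose_mul, Matrix.mul_nonsing_inv _ (isUnit_iff_ne_zero.2 hDr),
      Matrix.conjTranspose_one]
  rw [S.redH_of_det_ne_zero hDr, S.H_of_det_ne_zero hD, Matrix.conjTranspose_mul,
    Matrix.conjTranspose_mul, ← Matrix.mulVec_mulVec, ← Matrix.mulVec_mulVec,
    ← S.conjTranspose_redD_mulVec_eq hD hy, Matrix.mulVec_mulVec y, hinv, Matrix.one_mulVec,
    redB_eq, Matrix.conjTranspose_mul, Matrix.conjTranspose_conjTranspose,
    ← Matrix.mulVec_mulVec, hy, Matrix.mulVec_mulVec, Matrix.conjTranspose_mul,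
    Matrix.conjTranspose_mul]

theorem redH_eq_H (hD : (S.D μ (Complex.I * ω)).det ≠ 0)
    (hDr : (S.redD V W μ (Complex.I * ω)).det ≠ 0)
    (hV : S.newV μ ω ≤ col V) (hW : S.newW μ ω ≤ col W) :
    S.redH V W μ (Complex.I * ω) = S.H μ (Complex.I * ω) := by
  rcases le_or_gt m p with hmp | hpm
  · rw [newV, if_pos hmp] at hV
    exact Matrix.ext_iff_mulVec.2 fun v =>
      let ⟨_, hx⟩ := exists_mulVec_eq_of_col_le hV v
      S.redH_mulVec_eq hD hDr hx
  · rw [newW, if_pos hpm.le] at hW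
    exact Matrix.conjTranspose_injective <| Matrix.ext_iff_mulVec.2 fun u =>
      let ⟨_, hy⟩ := exists_mulVec_eq_of_col_le hW u
      S.conjTranspose_redH_mulVec_eq hD hDr hy

theorem exists_mulVec_eq_of_newV_le (hV : S.newV μ ω ≤ col V) {σ : ℂ} (hσ : σ ≠ 0)
    {u : Fin p → ℂ} {v : Fin m → ℂ} (hu : (S.H μ (Complex.I * ω))ᴴ *ᵥ u = σ • v) :
    ∃ x, V *ᵥ x = ((S.D μ (Complex.I * ω))⁻¹ * cplx (S.B μ)) *ᵥ v := by
  rcases le_or_gt m p with hmp | hpm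
  · rw [newV, if_pos hmp] at hV
    exact exists_mulVec_eq_of_col_le hV v
  · rw [newV, if_neg hpm.not_ge] at hV
    obtain ⟨x, hx⟩ := exists_mulVec_eq_of_col_le hV (σ⁻¹ • u)
    exact ⟨x, by rw [hx, ← Matrix.mulVec_mulVec, Matrix.mulVec_smul, hu, inv_smul_smul₀ hσ]⟩

theorem exists_mulVec_eq_of_newW_le (hW : S.newW μ ω ≤ col W) {σ : ℂ} (hσ : σ ≠ 0)
    {u : Fin p → ℂ} {v : Fin m → ℂ} (hv : S.H μ (Complex.I * ω) *ᵥ v = σ • u) :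
    ∃ y, W *ᵥ y = (((S.D μ (Complex.I * ω))⁻¹)ᴴ * (cplx (S.C μ))ᴴ) *ᵥ u := by
  rcases le_or_gt p m with hpm | hmp
  · rw [newW, if_pos hpm] at hW
    exact exists_mulVec_eq_of_col_le hW u
  · rw [newW, if_neg hmp.not_ge] at hW
    obtain ⟨y, hy⟩ := exists_mulVec_eq_of_col_le hW (σ⁻¹ • v)
    exact ⟨y, by rw [hy, ← Matrix.mulVec_mulVec, Matrix.mulVec_smul, hv, inv_smul_smul₀ hσ]⟩

-- Hermite interpolation along the singular pair `(u, v)`: the common derivative is the pairing of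
-- `i E(μ)` with the left and right directions, which both subspaces contain.
theorem exists_hasDerivAt_pairing (hD : (S.D μ (Complex.I * ω)).det ≠ 0)
    (hDr : (S.redD V W μ (Complex.I * ω)).det ≠ 0)
    (hV : S.newV μ ω ≤ col V) (hW : S.newW μ ω ≤ col W) {σ : ℂ} (hσ : σ ≠ 0)
    {u : Fin p → ℂ} {v : Fin m → ℂ} (hv : S.H μ (Complex.I * ω) *ᵥ v = σ • u)
    (hu : (S.H μ (Complex.I * ω))ᴴ *ᵥ u = σ • v) :
    ∃ c : ℂ, HasDerivAt (fun t : ℝ => star u ⬝ᵥ (S.H μ (Complex.I * t) *ᵥ v)) c ω ∧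
      HasDerivAt (fun t : ℝ => star u ⬝ᵥ (S.redH V W μ (Complex.I * t) *ᵥ v)) c ω := by
  obtain ⟨x, hx⟩ := S.exists_mulVec_eq_of_newV_le hV hσ hu
  obtain ⟨y, hy⟩ := S.exists_mulVec_eq_of_newW_le hW hσ hv
  have hfull := S.hasDerivAt_pairing_redH (V := (1 : Matrix (Fin n) (Fin n) ℂ)) (W := 1)
    (by rwa [redD_one]) (S.redD_mulVec_eq hD ((Matrix.one_mulVec _).trans hx))
    (S.conjTranspose_redD_mulVec_eq hD ((Matrix.one_mulVec _).trans hy))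
  simp only [Matrix.one_mulVec, redH_one] at hfull
  exact ⟨_, hfull, S.hasDerivAt_pairing_redH hDr (S.redD_mulVec_eq hD hx)
    (S.conjTranspose_redD_mulVec_eq hD hy)⟩

theorem hasDerivAt_redSigma_of_isPeak (hpeak : S.IsPeak μ ω)
    (hDr : (S.redD V W μ (Complex.I * ω)).det ≠ 0)
    (hV : S.newV μ ω ≤ col V) (hW : S.newW μ ω ≤ col W) (hpos : 0 < S.sigma μ ω)
    (hdiff : DifferentiableAt ℝ (S.redSigma V W μ) ω) :
    HasDerivAt (S.redSigma V W μ) 0 ω := by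
  have hD : (S.D μ (Complex.I * ω)).det ≠ 0 := isUnit_iff_ne_zero.1 hpeak.2
  obtain ⟨u, v, huu, hu, hv, hHv, hHu⟩ := exists_unit_singular_vectors hpos
  obtain ⟨c, hfull, hred⟩ := S.exists_hasDerivAt_pairing hD hDr hV hW
    (Complex.ofReal_ne_zero.2 hpos.ne') hHv hHu
  have hfull_re := Complex.reCLM.hasFDerivAt.comp_hasDerivAt ω hfull
  have hred_re := Complex.reCLM.hasFDerivAt.comp_hasDerivAt ω hred
  have hle (M : Matrix (Fin p) (Fin m) ℂ) : (star u ⬝ᵥ (M *ᵥ v)).re ≤ svalMax M := by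
    simpa only [hu, hv, mul_one] using
      (Complex.re_le_norm _).trans (norm_star_dotProduct_mulVec_le M u v)
  have hω : (star u ⬝ᵥ (S.H μ (Complex.I * ω) *ᵥ v)).re = S.sigma μ ω := by
    rw [hHv, dotProduct_smul, huu, smul_eq_mul, mul_one, Complex.ofReal_re, sigma]
  have hHeq := S.redH_eq_H hD hDr hV hW
  have hc : Complex.reCLM c = 0 := IsLocalMax.hasDerivAt_eq_zero
    (.of_forall fun t => ((hle _).trans (hpeak.1 t)).trans_eq hω.symm) hfull_re
  rw [hc] at hred_re
  exact hasDerivAt_of_le_of_eq hred_re hdiff (fun t => hle _) (by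
    change (star u ⬝ᵥ (S.redH V W μ (Complex.I * ω) *ᵥ v)).re = _
    rw [hHeq, hω, redSigma, hHeq, sigma])

end ParamSystem

/-! ### The Hardy norm -/

theorem denom_eval_ne_zero_of_norm_eval_le {f : RatFunc ℂ} {c : ℝ}
    (h : ∀ s : ℂ, 0 < s.re → ‖RatFunc.eval (RingHom.id ℂ) s f‖ ≤ c) {s₀ : ℂ} (hs₀ : 0 ≤ s₀.re) :
    f.denom.eval s₀ ≠ 0 := by
  intro hdenom
  have hdense : Dense {s : ℂ | f.denom.eval s ≠ 0} := by
    refine (f.denom.roots.toFinset.countable_toSet.dense_compl ℝ).mono fun s hs => ?_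
    simpa [f.denom_ne_zero] using hs
  have hclosure : s₀ ∈ closure ({s : ℂ | 0 < s.re} ∩ {s | f.denom.eval s ≠ 0}) := by
    refine closure_minimal (hdense.open_subset_closure_inter
      (isOpen_lt continuous_const Complex.continuous_re)) isClosed_closure ?_
    rwa [Complex.closure_setOfPred_lt_re]
  have hnum : ‖f.num.eval s₀‖ ≤ c * ‖f.denom.eval s₀‖ := by
    refine le_on_closure (fun s hs => ?_) f.num.continuous.norm.continuousOn
      (continuous_const.mul f.denom.continuous.norm).continuousOn hclosure
    refine (div_le_iff₀ (norm_pos_iff.2 hs.2)).1 ?_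
    rw [← norm_div]
    simpa only [RatFunc.eval, Polynomial.eval₂_id] using h s hs.1
  rw [hdenom, norm_zero, mul_zero, norm_le_zero_iff] at hnum
  obtain ⟨a, b, hab⟩ := f.isCoprime_num_denom
  simpa [hnum, hdenom] using congrArg (Polynomial.eval s₀) hab

section

attribute [local instance] Matrix.normedAddCommGroup Matrix.normedSpace

variable {p m : ℕ} {G : Matrix (Fin p) (Fin m) (RatFunc ℂ)} {b c : ℝ}

theorem differentiableAt_evalAt (hG : ∀ s : ℂ, 0 < s.re → svalMax (evalAt G s) ≤ c) {s : ℂ}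
    (hs : 0 ≤ s.re) : DifferentiableAt ℂ (evalAt G) s := by
  refine differentiableAt_pi.2 fun i => differentiableAt_pi.2 fun j => ?_
  have hdenom := denom_eval_ne_zero_of_norm_eval_le (f := G i j)
    (fun z hz => (norm_apply_le_svalMax (evalAt G z) i j).trans (hG z hz)) hs
  simp only [evalAt, Matrix.map_apply, RatFunc.eval, Polynomial.eval₂_id]
  exact (G i j).num.differentiableAt.div (G i j).denom.differentiableAt hdenom

theorem svalMax_evalAt_le_of_forall_imaginary
    (hG : ∀ s : ℂ, 0 < s.re → svalMax (evalAt G s) ≤ c)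
    (hb : ∀ ω : ℝ, svalMax (evalAt G (Complex.I * ω)) ≤ b) {s : ℂ} (hs : 0 ≤ s.re) :
    svalMax (evalAt G s) ≤ b := by
  simp only [svalMax_eq_norm] at hG hb ⊢
  have hdiff {z : ℂ} (hz : 0 ≤ z.re) : DifferentiableAt ℂ (fun z => euclideanOp (evalAt G z)) z :=
    euclideanOp.differentiableAt.comp z
      (differentiableAt_evalAt (by simpa only [svalMax_eq_norm] using hG) hz)
  refine PhragmenLindelof.right_half_plane_of_bounded_on_real
    (f := fun z => euclideanOp (evalAt G z)) ⟨fun z hz => ?_, fun z hz => ?_⟩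
    ⟨0, two_pos, 0, .of_bound c ?_⟩ (isBoundedUnder_of_eventually_le (a := c) ?_)
    (fun ω => by simpa only [mul_comm] using hb ω) hs
  · exact (hdiff (le_of_lt hz)).differentiableWithinAt
  · rw [Complex.closure_setOfPred_lt_re] at hz
    exact (hdiff hz).continuousAt.continuousWithinAt
  · refine eventually_inf_principal.2 (.of_forall fun z hz => ?_)
    simpa using hG z hz
  · exact (eventually_gt_atTop 0).mono fun x hx => hG x (by simpa using hx)

end

namespace ParamSystem

variable {d n m p : ℕ} {S : ParamSystem d n m p} {μ : EuclideanSpace ℝ (Fin d)}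

theorem InHinf.svalMax_le (h : S.InHinf μ) {s : ℂ} (hs : 0 < s.re) :
    svalMax (S.H μ s) ≤ (S.hInfNorm μ).toReal :=
  (ENNReal.ofReal_le_iff_le_toReal h.2.ne).1 <|
    le_iSup (fun z : {z : ℂ // 0 < z.re} => ENNReal.ofReal (svalMax (S.H μ z))) ⟨s, hs⟩

theorem InHinf.continuousAt_H (h : S.InHinf μ) {s : ℂ} (hs : 0 ≤ s.re) : ContinuousAt (S.H μ) s :=
  (differentiableAt_evalAt (fun _ => h.svalMax_le) hs).continuousAt

theorem InHinf.continuous_sigma (h : S.InHinf μ) : Continuous (S.sigma μ) := by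
  refine continuous_svalMax.comp (continuous_iff_continuousAt.2 fun ω => ?_)
  exact (h.continuousAt_H (by simp)).comp (f := fun t : ℝ => Complex.I * t) (by fun_prop)

theorem InHinf.sigma_le (h : S.InHinf μ) (ω : ℝ) : S.sigma μ ω ≤ (S.hInfNorm μ).toReal := by
  have hcont : ContinuousOn (fun s => svalMax (S.H μ s)) (closure {s | 0 < s.re}) := fun s hs =>
    (continuous_svalMax.continuousAt.comp
      (h.continuousAt_H (by rwa [Complex.closure_setOfPred_lt_re] at hs))).continuousWithinAt
  have hmem : Complex.I * ω ∈ closure {s : ℂ | 0 < s.re} := by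
    rw [Complex.closure_setOfPred_lt_re]
    simp
  exact le_on_closure (fun s => h.svalMax_le) hcont continuousOn_const hmem

theorem InHinf.hInfNorm_eq (h : S.InHinf μ) {w : ℝ} (hw : ∀ ω, S.sigma μ ω ≤ S.sigma μ w) :
    S.hInfNorm μ = ENNReal.ofReal (S.sigma μ w) :=
  le_antisymm
    (iSup_le fun s => ENNReal.ofReal_le_ofReal <|
      svalMax_evalAt_le_of_forall_imaginary (fun _ => h.svalMax_le) hw s.2.le)
    ((ENNReal.ofReal_le_iff_le_toReal h.2.ne).2 (h.sigma_le w))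

end ParamSystem

/-! ### Symmetry in the frequency -/

theorem svalMax_conjTranspose_transpose {a b : ℕ} (M : Matrix (Fin a) (Fin b) ℂ) :
    svalMax Mᴴᵀ = svalMax M := by
  have hle (N : Matrix (Fin a) (Fin b) ℂ) : svalMax Nᴴᵀ ≤ svalMax N := by
    rcases le_or_gt (svalMax Nᴴᵀ) 0 with h0 | hpos
    · exact h0.trans (sval_nonneg N 0)
    obtain ⟨u, v, huu, hu, hv, hNv, -⟩ := exists_unit_singular_vectors hpos
    have hstar {k : ℕ} (x : Fin k → ℂ) : ‖WithLp.toLp 2 (star x)‖ = ‖WithLp.toLp 2 x‖ := by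
      simp [EuclideanSpace.norm_eq]
    have hval : star (star u ⬝ᵥ (Nᴴᵀ *ᵥ v)) = star (star u) ⬝ᵥ (N *ᵥ star v) := by
      simp [Matrix.mulVec, dotProduct]
    calc svalMax Nᴴᵀ = ‖star u ⬝ᵥ (Nᴴᵀ *ᵥ v)‖ := by
          rw [hNv, dotProduct_smul, huu, smul_eq_mul, mul_one, Complex.norm_real,
            Real.norm_of_nonneg hpos.le]
      _ ≤ svalMax N := by
          rw [← norm_star, hval]
          simpa only [hstar, hu, hv, mul_one] using
            norm_star_dotProduct_mulVec_le N (star u) (star v)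
  have hinv : Mᴴᵀᴴᵀ = M := by
    ext i j
    simp
  exact (hle M).antisymm ((congrArg svalMax hinv).symm.trans_le (hle Mᴴᵀ))

theorem conjTranspose_transpose_cplx {a b : ℕ} (M : Matrix (Fin a) (Fin b) ℝ) :
    (cplx M)ᴴᵀ = cplx M := by
  ext i j
  simp [cplx]

namespace ParamSystem

variable {d n m p : ℕ} {S : ParamSystem d n m p} {μ : EuclideanSpace ℝ (Fin d)}

theorem D_star (s : ℂ) : S.D μ (star s) = (S.D μ s)ᴴᵀ := by
  simp only [D, Matrix.conjTranspose_sub, Matrix.conjTranspose_smul, Matrix.transpose_sub,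
    Matrix.transpose_smul, conjTranspose_transpose_cplx]

theorem H_star {s : ℂ} (hD : (S.D μ s).det ≠ 0) : S.H μ (star s) = (S.H μ s)ᴴᵀ := by
  have hD' : (S.D μ (star s)).det ≠ 0 := by
    rwa [D_star, Matrix.det_transpose, Matrix.det_conjTranspose, star_ne_zero]
  rw [S.H_of_det_ne_zero hD', S.H_of_det_ne_zero hD, D_star]
  simp only [Matrix.conjTranspose_mul, Matrix.transpose_mul, Matrix.conjTranspose_nonsing_inv,
    Matrix.transpose_nonsing_inv, conjTranspose_transpose_cplx, Matrix.mul_assoc]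

theorem sigma_neg {ω : ℝ} (hD : (S.D μ (Complex.I * ω)).det ≠ 0) :
    S.sigma μ (-ω) = S.sigma μ ω := by
  have hstar : Complex.I * ((-ω : ℝ) : ℂ) = star (Complex.I * ω) := by simp
  rw [sigma, sigma, hstar, H_star hD, svalMax_conjTranspose_transpose]

end ParamSystem

/-! ### Localization of maximizers -/

/-- Outside the closed interval of radius `b` about `w` and its mirror image, the supremum of `s`
is smaller than `s w`. Only this consequence of unique maximality at `w` persists under uniform
perturbations of `s`. -/
def IsDominatedAway (s : ℝ → ℝ) (w b : ℝ) : Prop :=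
  ∃ c < s w, ∀ ω, ω ∉ closedBall w b → -ω ∉ closedBall w b → s ω ≤ c

section Localization

variable {s : ℝ → ℝ} {w b : ℝ}

theorem IsUniqueMax.le (hmax : IsUniqueMax s w) (heven : s (-w) = s w) (ω : ℝ) : s ω ≤ s w := by
  by_cases h : |ω| = |w|
  · rcases abs_eq_abs.1 h with rfl | rfl
    exacts [le_rfl, heven.le]
  · exact (hmax.1 ω h).le

theorem IsUniqueMax.isDominatedAway (hmax : IsUniqueMax s w) (hs : Continuous s) (hb : 0 < b) :
    IsDominatedAway s w b := by
  obtain ⟨c, hc, hev⟩ := hmax.2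
  obtain ⟨K, hK, hKc⟩ := mem_cocompact.1 hev
  have hL : IsCompact (K \ (ball w b ∪ (fun ω => -ω) ⁻¹' ball w b)) :=
    hK.diff (isOpen_ball.union (isOpen_ball.preimage continuous_neg))
  have hcover {ω : ℝ} (h₁ : ω ∉ closedBall w b) (h₂ : -ω ∉ closedBall w b) :
      s ω ≤ c ∨ ω ∈ K \ (ball w b ∪ (fun ω => -ω) ⁻¹' ball w b) := by
    by_cases hω : ω ∈ K
    · exact Or.inr ⟨hω, fun h => h.elim (fun h => h₁ (ball_subset_closedBall h))
        fun h => h₂ (ball_subset_closedBall h)⟩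
    · exact Or.inl (hKc hω)
  rcases (K \ (ball w b ∪ (fun ω => -ω) ⁻¹' ball w b)).eq_empty_or_nonempty with hempty | hne
  · refine ⟨c, hc, fun ω h₁ h₂ => (hcover h₁ h₂).resolve_right ?_⟩
    simp only [hempty, mem_empty_iff_false, not_false_iff]
  · obtain ⟨x, hxL, hx⟩ := hL.exists_isMaxOn hne hs.continuousOn
    have hxw : |x| ≠ |w| := fun h => hxL.2 <| by
      rcases abs_eq_abs.1 h with rfl | rfl
      exacts [Or.inl (mem_ball_self hb), Or.inr (by simpa using hb)]
    exact ⟨max c (s x), max_lt hc (hmax.1 x hxw), fun ω h₁ h₂ =>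
      le_max_iff.2 ((hcover h₁ h₂).imp_right fun h => hx h)⟩

theorem IsDominatedAway.eventually_of_tendstoUniformly {ι : Type*} {l : Filter ι}
    {F : ι → ℝ → ℝ} (hs : IsDominatedAway s w b) (hF : TendstoUniformly F s l) :
    ∀ᶠ i in l, IsDominatedAway (F i) w b := by
  obtain ⟨c, hc, hfar⟩ := hs
  filter_upwards [Metric.tendstoUniformly_iff.1 hF ((s w - c) / 3) (by linarith)] with i hi
  simp only [Real.dist_eq, abs_lt] at hi
  refine ⟨c + (s w - c) / 3, by linarith [(hi w).2], fun ω h₁ h₂ => ?_⟩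
  linarith [(hi ω).1, hfar ω h₁ h₂]

theorem IsDominatedAway.isUniqueMax {v : ℝ} (hs : IsDominatedAway s w b) (hb : 0 ≤ b)
    (heven : ∀ ω ∈ closedBall w b, s (-ω) = s ω)
    (hv : ∀ ω ∈ closedBall w b, ω ≠ v → s ω < s v) : IsUniqueMax s v := by
  obtain ⟨c, hc, hfar⟩ := hs
  have hle : s w ≤ s v := by
    by_cases h : w = v
    · rw [h]
    · exact (hv w (mem_closedBall_self hb) h).le
  refine ⟨fun ω hω => ?_, c, hc.trans_le hle, ?_⟩
  · by_cases h₁ : ω ∈ closedBall w b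
    · exact hv ω h₁ fun h => hω (by rw [h])
    by_cases h₂ : -ω ∈ closedBall w b
    · rw [← neg_neg ω, heven _ h₂]
      exact hv _ h₂ fun h => hω (by rw [← h, abs_neg])
    · exact (hfar ω h₁ h₂).trans_lt (hc.trans_le hle)
  · have hK : IsCompact (closedBall w b ∪ (fun ω => -ω) ⁻¹' closedBall w b) :=
      (isCompact_closedBall w b).union
        ((Homeomorph.neg ℝ).isCompact_preimage.2 (isCompact_closedBall w b))
    exact mem_cocompact.2 ⟨_, hK, fun ω hω =>
      hfar ω (fun h => hω (Or.inl h)) fun h => hω (Or.inr h)⟩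

theorem IsDominatedAway.mem_closedBall {v : ℝ} (hs : IsDominatedAway s w b)
    (hv : ∀ ω, s ω ≤ s v) (hsign : 0 ≤ v * w) : v ∈ closedBall w b := by
  obtain ⟨c, hc, hfar⟩ := hs
  by_contra h₁
  have h₂ : -v ∈ closedBall w b := by
    by_contra h₂
    linarith [hfar v h₁ h₂, hv w]
  refine h₁ (Metric.mem_closedBall.2 (le_trans ?_ (Metric.mem_closedBall.1 h₂)))
  rw [Real.dist_eq, Real.dist_eq]
  exact sq_le_sq.1 (by nlinarith)

end Localization

/-! ### Uniformity over compact families of projection matrices -/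

section ClosedBall

variable {X Y : Type*} [PseudoMetricSpace X] [PseudoMetricSpace Y]

theorem eventually_forall_closedBall {P : X → Prop} {x : X} (h : ∀ᶠ x' in 𝓝 x, P x') :
    ∀ᶠ a in 𝓝[>] (0 : ℝ), ∀ x' ∈ closedBall x a, P x' := by
  obtain ⟨r, hr, hP⟩ := nhds_basis_closedBall.eventually_iff.1 h
  filter_upwards [mem_nhdsWithin_of_mem_nhds (Iic_mem_nhds hr)] with a ha x' hx'
  exact hP (closedBall_subset_closedBall ha hx')

theorem eventually_forall_closedBall_prod {P : X × Y → Prop} {x : X} {y : Y}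
    (h : ∀ᶠ z in 𝓝 (x, y), P z) :
    ∀ᶠ b in 𝓝[>] (0 : ℝ), ∀ᶠ a in 𝓝[>] (0 : ℝ),
      ∀ x' ∈ closedBall x a, ∀ y' ∈ closedBall y b, P (x', y') := by
  rw [nhds_prod_eq] at h
  obtain ⟨Px, hx, Py, hy, hP⟩ := eventually_prod_iff.1 h
  filter_upwards [eventually_forall_closedBall hy] with b hb
  filter_upwards [eventually_forall_closedBall hx] with a ha x' hx' y' hy'
  exact hP (ha x' hx') (hb y' hy')

end ClosedBall

theorem isCompact_inter_preimage {X Y : Type*} [TopologicalSpace X] [T2Space X]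
    [TopologicalSpace Y] {f : X → Y} {K : Set X} {t : Set Y} (hK : IsCompact K)
    (hf : ContinuousOn f K) (ht : IsClosed t) : IsCompact (K ∩ f ⁻¹' t) :=
  hK.of_isClosed_subset (hf.preimage_isClosed_of_isClosed hK.isClosed ht) inter_subset_left

section Families

attribute [local instance] Matrix.normedAddCommGroup Matrix.normedSpace

theorem norm_le_one_of_conjTranspose_mul_self {n r : ℕ} {V : Matrix (Fin n) (Fin r) ℂ}
    (hV : Vᴴ * V = 1) : ‖V‖ ≤ 1 := by
  refine (Matrix.norm_le_iff zero_le_one).2 fun i j => ?_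
  have hcol : ∑ k, ‖V k j‖ ^ 2 = 1 := by
    have hjj := congrFun (congrFun hV j) j
    simp only [Matrix.mul_apply, Matrix.conjTranspose_apply, Matrix.one_apply_eq,
      RCLike.star_def, Complex.conj_mul'] at hjj
    exact_mod_cast hjj
  have hle : ‖V i j‖ ^ 2 ≤ ∑ k, ‖V k j‖ ^ 2 :=
    Finset.single_le_sum (f := fun k => ‖V k j‖ ^ 2) (fun k _ => by positivity) (Finset.mem_univ i)
  exact (sq_le_one_iff₀ (norm_nonneg _)).1 (hle.trans_eq hcol)

theorem le_of_conjTranspose_mul_self {n r : ℕ} {V : Matrix (Fin n) (Fin r) ℂ}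
    (hV : Vᴴ * V = 1) : r ≤ n :=
  calc r = (Vᴴ * V).rank := by rw [hV, Matrix.rank_one, Fintype.card_fin]
    _ ≤ V.rank := Matrix.rank_mul_le_right Vᴴ V
    _ ≤ n := V.rank_le_height

namespace ParamSystem

variable {d n m p : ℕ} (S : ParamSystem d n m p) (μs : EuclideanSpace ℝ (Fin d)) (ωs β γ δ : ℝ)
  (r : ℕ)

/-- The pairs of matrices with orthonormal columns for which the reduced pencil at the base point
has smallest singular value at least `β`. -/
def stablePairs : Set (ProjectionPair n r) :=
  {q | (q.1ᴴ * q.1 = 1 ∧ q.2ᴴ * q.2 = 1) ∧ β ≤ svalMin (S.redD q.1 q.2 μs (Complex.I * ωs))}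

/-- The stable pairs for which, at the base point, the two largest singular values of the reduced
system are at least `γ` apart and the largest one has second derivative at most `δ`. -/
def peakedPairs : Set (ProjectionPair n r) :=
  S.stablePairs μs ωs β r ∩ (fun q => S.redGap q μs ωs) ⁻¹' Ici γ ∩
    (fun q => deriv (deriv (S.redSigma q.1 q.2 μs)) ωs) ⁻¹' Iic δ

variable {S μs ωs β γ δ r}

theorem det_redD_ne_zero_of_mem_stablePairs (hβ : 0 < β) {q : ProjectionPair n r}
    (hq : q ∈ S.stablePairs μs ωs β r) : (S.redD q.1 q.2 μs (Complex.I * ωs)).det ≠ 0 :=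
  det_ne_zero_of_svalMin_pos (hβ.trans_le hq.2)

theorem isCompact_stablePairs : IsCompact (S.stablePairs μs ωs β r) := by
  have : ProperSpace (Matrix (Fin n) (Fin r) ℂ) :=
    inferInstanceAs (ProperSpace (Fin n → Fin r → ℂ))
  have hclosed : IsClosed (S.stablePairs μs ωs β r) := by
    refine ((isClosed_eq ?_ continuous_const).inter (isClosed_eq ?_ continuous_const)).inter
      (isClosed_le continuous_const (continuous_svalMin.comp ?_))
    · exact continuous_fst.matrix_conjTranspose.matrix_mul continuous_fst
    · exact continuous_snd.matrix_conjTranspose.matrix_mul continuous_snd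
    · simp only [redD_eq]
      exact (continuous_snd.matrix_conjTranspose.matrix_mul continuous_const).matrix_mul
        continuous_fst
  refine (isCompact_closedBall (0 : ProjectionPair n r) 1).of_isClosed_subset hclosed ?_
  intro q hq
  rw [mem_closedBall_zero_iff, Prod.norm_def]
  exact max_le (norm_le_one_of_conjTranspose_mul_self hq.1.1)
    (norm_le_one_of_conjTranspose_mul_self hq.1.2)

theorem contDiffAt_redSigma_of_mem_stablePairs (hμs : μs ∈ S.Ω) (hβ : 0 < β)
    {q : ProjectionPair n r} (hq : q ∈ S.stablePairs μs ωs β r) (hgap : 0 < S.redGap q μs ωs) :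
    ContDiffAt ℝ 4 (fun y : (ProjectionPair n r × EuclideanSpace ℝ (Fin d)) × ℝ =>
      S.redSigma y.1.1.1 y.1.1.2 y.1.2 y.2) ((q, μs), ωs) :=
  S.contDiffAt_redSigma (x := ((q, μs), ωs)) (by norm_num) hμs
    (det_redD_ne_zero_of_mem_stablePairs hβ hq) (sub_pos.1 hgap)
    contDiff_fst.fst.fst.contDiffAt contDiff_fst.fst.snd.contDiffAt
    contDiff_fst.snd.contDiffAt contDiff_snd.contDiffAt

theorem isCompact_peakedPairs (hμs : μs ∈ S.Ω) (hβ : 0 < β) (hγ : 0 < γ) :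
    IsCompact (S.peakedPairs μs ωs β γ δ r) := by
  have hbase (q : ProjectionPair n r) :
      ContinuousAt (fun q' : ProjectionPair n r => ((q', μs), ωs)) q := by fun_prop
  refine isCompact_inter_preimage
    (isCompact_inter_preimage isCompact_stablePairs (fun q hq => ?_) isClosed_Ici)
    (fun q hq => ?_) isClosed_Iic
  · exact (ContinuousAt.comp (x := q) (S.continuousAt_redGap (z := ((q, μs), ωs)) hμs
      (det_redD_ne_zero_of_mem_stablePairs hβ hq)) (hbase q)).continuousWithinAt
  · have hcontDiff := contDiffAt_redSigma_of_mem_stablePairs hμs hβ hq.1 (hγ.trans_le hq.2)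
    have hderiv := contDiffAt_deriv_snd (n := 3) (by convert hcontDiff using 1; norm_num)
    have hderiv2 := contDiffAt_deriv_snd (n := 2) (by convert hderiv using 1; norm_num)
    exact (ContinuousAt.comp (x := q) hderiv2.continuousAt (hbase q)).continuousWithinAt

theorem eventually_forall_stablePairs (hμs : μs ∈ S.Ω) (hβ : 0 < β) (hγ : 0 < γ) :
    ∀ᶠ z : EuclideanSpace ℝ (Fin d) × ℝ in 𝓝 (μs, ωs), ∀ q ∈ S.stablePairs μs ωs β r,
      (S.redD q.1 q.2 z.1 (Complex.I * z.2)).det ≠ 0 ∧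
        dist (S.redGap q z.1 z.2) (S.redGap q μs ωs) < γ := by
  have hswap (q : ProjectionPair n r) : ContinuousAt
      (fun y : (EuclideanSpace ℝ (Fin d) × ℝ) × ProjectionPair n r => ((y.2, y.1.1), y.1.2))
      ((μs, ωs), q) := by fun_prop
  have hdet : ∀ᶠ z : EuclideanSpace ℝ (Fin d) × ℝ in 𝓝 (μs, ωs),
      ∀ q ∈ S.stablePairs μs ωs β r, (S.redD q.1 q.2 z.1 (Complex.I * z.2)).det ≠ 0 := by
    refine isCompact_stablePairs.eventually_forall_of_forall_eventually fun q hq => ?_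
    have hD := S.contDiffAt_redD (N := 0) (x := ((μs, ωs), q)) (V := fun y => y.2.1)
      (W := fun y => y.2.2) (μ := fun y => y.1.1) (ω := fun y => y.1.2) hμs
      contDiff_snd.fst.contDiffAt contDiff_snd.snd.contDiffAt contDiff_fst.fst.contDiffAt
      contDiff_fst.snd.contDiffAt
    exact (contDiffAt_det hD).continuousAt.eventually_ne
      (det_redD_ne_zero_of_mem_stablePairs hβ hq)
  have hgap := eventually_forall_dist_lt (x := (μs, ωs)) isCompact_stablePairs (fun q hq =>
    ContinuousAt.comp (x := ((μs, ωs), q)) (S.continuousAt_redGap (z := ((q, μs), ωs)) hμs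
      (det_redD_ne_zero_of_mem_stablePairs hβ hq)) (hswap q)) hγ
  filter_upwards [hdet, hgap] with z hz hz' q hq using ⟨hz q hq, hz' q hq⟩

variable (S μs ωs β γ δ r) in
/-- A neighbourhood `closedBall μs a × closedBall ωs b` of the base point on which all reduced
systems of order `r` can be treated uniformly: for the stable pairs the pencil stays invertible and
the gap varies by less than `γ`, and for the pairs with gap at least `2 * γ` at the base point the
stationary points in the half-size interval extend to concave branches. -/
structure IsUniformBox (a b : ℝ) : Prop where
  pos_left : 0 < a
  pos_right : 0 < b
  closedBall_subset : closedBall μs a ⊆ S.Ω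
  det_ne_zero_and_dist_lt : ∀ μ ∈ closedBall μs a, ∀ ω ∈ closedBall ωs b,
    ∀ q ∈ S.stablePairs μs ωs β r, (S.redD q.1 q.2 μ (Complex.I * ω)).det ≠ 0 ∧
      dist (S.redGap q μ ω) (S.redGap q μs ωs) < γ
  exists_branch : ∀ q ∈ S.peakedPairs μs ωs β (2 * γ) δ r, ∀ μ₀ ∈ closedBall μs a,
    ∀ ω₀ ∈ closedBall ωs (b / 2), HasDerivAt (S.redSigma q.1 q.2 μ₀) 0 ω₀ →
      ∃ w, IsConcaveBranch (S.redSigma q.1 q.2) μs ωs a b (δ / 2) μ₀ ω₀ w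

theorem eventually_isUniformBox (hμs : μs ∈ S.Ω) (hβ : 0 < β) (hγ : 0 < γ) (hδ : δ < 0) (r : ℕ) :
    ∀ᶠ b in 𝓝[>] (0 : ℝ), ∀ᶠ a in 𝓝[>] (0 : ℝ), S.IsUniformBox μs ωs β γ δ r a b := by
  have hbranch := eventually_exists_isConcaveBranch
    (F := fun (q : ProjectionPair n r) μ ω => S.redSigma q.1 q.2 μ ω)
    (isCompact_peakedPairs (ωs := ωs) hμs hβ (mul_pos two_pos hγ)) hδ
    (fun q hq => contDiffAt_redSigma_of_mem_stablePairs hμs hβ hq.1.1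
      ((mul_pos two_pos hγ).trans_le hq.1.2)) (fun q hq => hq.2)
  have hnear := eventually_forall_closedBall_prod
    (eventually_forall_stablePairs (ωs := ωs) (r := r) hμs hβ hγ)
  filter_upwards [hbranch, hnear, self_mem_nhdsWithin] with b hbranch hnear hb
  filter_upwards [hbranch, hnear, self_mem_nhdsWithin,
    eventually_forall_closedBall (S.isOpen_Ω.mem_nhds hμs)] with a hbranch hnear ha hΩ
  exact ⟨ha, hb, hΩ, hnear, hbranch⟩

end ParamSystem

end Families

namespace ParamSystem

variable {d n m p r : ℕ} {S : ParamSystem d n m p} {μs : EuclideanSpace ℝ (Fin d)}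
  {ωs β γ δ a b : ℝ}

/-! ### Branches of the full and the reduced systems -/

theorem exists_isUniformBox (hμs : μs ∈ S.Ω) (hβ : 0 < β) (hγ : 0 < γ) (hδ : δ < 0)
    {P : ℝ → EuclideanSpace ℝ (Fin d) → Prop} (hP : ∀ b > 0, ∀ᶠ μ in 𝓝 μs, P b μ) :
    ∃ a b, (∀ r ≤ n, S.IsUniformBox μs ωs β γ δ r a b) ∧ ∀ μ ∈ closedBall μs a, P b μ := by
  obtain ⟨b, hbox, hb⟩ := (((eventually_all_finite (finite_Iic n)).2 fun r _ =>
    eventually_isUniformBox (ωs := ωs) hμs hβ hγ hδ r).and self_mem_nhdsWithin).exists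
  obtain ⟨a, hbox, hPa⟩ := (((eventually_all_finite (finite_Iic n)).2 hbox).and
    (eventually_forall_closedBall (hP b hb))).exists
  exact ⟨a, b, hbox, hPa⟩

theorem redGap_one (μ : EuclideanSpace ℝ (Fin d)) (ω : ℝ) :
    S.redGap ((1, 1) : ProjectionPair n n) μ ω = S.sigma μ ω - S.sigmaSecond μ ω := by
  rw [redGap, redSigma_one, redSigmaSecond_one]

theorem one_mem_stablePairs (hβ : β ≤ svalMin (S.D μs (Complex.I * ωs))) :
    ((1, 1) : ProjectionPair n n) ∈ S.stablePairs μs ωs β n := by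
  refine ⟨⟨?_, ?_⟩, ?_⟩
  · rw [Matrix.conjTranspose_one, one_mul]
  · rw [Matrix.conjTranspose_one, one_mul]
  · rwa [redD_one]

theorem one_mem_peakedPairs (hβ : β ≤ svalMin (S.D μs (Complex.I * ωs)))
    (hgap : γ ≤ S.sigma μs ωs - S.sigmaSecond μs ωs) (hδ : deriv (deriv (S.sigma μs)) ωs ≤ δ) :
    ((1, 1) : ProjectionPair n n) ∈ S.peakedPairs μs ωs β γ δ n := by
  refine ⟨⟨one_mem_stablePairs hβ, ?_⟩, ?_⟩
  · rwa [mem_preimage, redGap_one]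
  · rwa [mem_preimage, redSigma_one]

namespace IsUniformBox

variable (hbox : S.IsUniformBox μs ωs β γ δ r a b)

include hbox

theorem lt_redGap {q : ProjectionPair n r} (hq : q ∈ S.peakedPairs μs ωs β (2 * γ) δ r)
    {μ : EuclideanSpace ℝ (Fin d)} (hμ : μ ∈ closedBall μs a) {ω : ℝ} (hω : ω ∈ closedBall ωs b) :
    γ < S.redGap q μ ω := by
  have hdist := (abs_lt.1 (hbox.det_ne_zero_and_dist_lt μ hμ ω hω q hq.1.1).2).1
  have hbase : 2 * γ ≤ S.redGap q μs ωs := hq.1.2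
  linarith

theorem differentiableAt_redSigma (hγ : 0 < γ) {q : ProjectionPair n r}
    (hq : q ∈ S.peakedPairs μs ωs β (2 * γ) δ r) {μ : EuclideanSpace ℝ (Fin d)}
    (hμ : μ ∈ closedBall μs a) {ω : ℝ} (hω : ω ∈ closedBall ωs b) :
    DifferentiableAt ℝ (S.redSigma q.1 q.2 μ) ω :=
  S.differentiableAt_redSigma (hbox.closedBall_subset hμ)
    (hbox.det_ne_zero_and_dist_lt μ hμ ω hω q hq.1.1).1
    (sub_pos.1 (hγ.trans (hbox.lt_redGap hq hμ hω)))

end IsUniformBox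

section Full

variable (hbox : S.IsUniformBox μs ωs β γ δ n a b)
  (hβ : β ≤ svalMin (S.D μs (Complex.I * ωs)))
include hbox hβ

theorem IsUniformBox.det_D_ne_zero {μ : EuclideanSpace ℝ (Fin d)} (hμ : μ ∈ closedBall μs a)
    {ω : ℝ} (hω : ω ∈ closedBall ωs b) : (S.D μ (Complex.I * ω)).det ≠ 0 := by
  have hdet := (hbox.det_ne_zero_and_dist_lt μ hμ ω hω _ (one_mem_stablePairs hβ)).1
  rwa [redD_one] at hdet

theorem IsUniformBox.abs_gap_sub_gap_lt {μ : EuclideanSpace ℝ (Fin d)} (hμ : μ ∈ closedBall μs a)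
    {ω : ℝ} (hω : ω ∈ closedBall ωs b) :
    |S.sigma μ ω - S.sigmaSecond μ ω - (S.sigma μs ωs - S.sigmaSecond μs ωs)| < γ := by
  have hdist := (hbox.det_ne_zero_and_dist_lt μ hμ ω hω _ (one_mem_stablePairs hβ)).2
  rwa [redGap_one, redGap_one] at hdist

theorem IsUniformBox.exists_full_branch (hγ : 0 < γ)
    (hgap : 2 * γ ≤ S.sigma μs ωs - S.sigmaSecond μs ωs)
    (hδ : deriv (deriv (S.sigma μs)) ωs ≤ δ) (hmax : IsUniqueMax (S.sigma μs) ωs) :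
    ∃ w, IsConcaveBranch S.sigma μs ωs a b (δ / 2) μs ωs w := by
  have hμs : μs ∈ closedBall μs a := mem_closedBall_self hbox.pos_left.le
  have hωs : ωs ∈ closedBall ωs b := mem_closedBall_self hbox.pos_right.le
  have hone := one_mem_peakedPairs hβ hgap hδ
  have hdiff := hbox.differentiableAt_redSigma hγ hone hμs hωs
  have hbranch := hbox.exists_branch _ hone μs hμs ωs
    (mem_closedBall_self (half_pos hbox.pos_right).le)
  rw [redSigma_one] at hdiff hbranch
  have hlocmax : IsLocalMax (S.sigma μs) ωs :=
    .of_forall (hmax.le (sigma_neg (hbox.det_D_ne_zero hβ hμs hωs)))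
  exact hbranch (hlocmax.deriv_eq_zero ▸ hdiff.hasDerivAt)

theorem IsUniformBox.full_branch_properties {w : EuclideanSpace ℝ (Fin d) → ℝ}
    (hw : IsConcaveBranch S.sigma μs ωs a b (δ / 2) μs ωs w)
    (hgap : 2 * γ ≤ S.sigma μs ωs - S.sigmaSecond μs ωs)
    {μ : EuclideanSpace ℝ (Fin d)} (hμ : μ ∈ closedBall μs a) (hH : S.InHinf μ)
    (hdom : IsDominatedAway (S.sigma μ) ωs b) :
    γ ≤ S.sigma μ (w μ) - S.sigmaSecond μ (w μ) ∧ IsUniqueMax (S.sigma μ) (w μ) ∧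
      (ωs = 0 → w μ = 0) ∧ S.hInfNorm μ = ENNReal.ofReal (S.sigma μ (w μ)) := by
  have hwμ : w μ ∈ closedBall ωs b := hw.isUnique.1.mapsTo hμ
  have heven : ∀ ω ∈ closedBall ωs b, S.sigma μ (-ω) = S.sigma μ ω :=
    fun ω hω => sigma_neg (hbox.det_D_ne_zero hβ hμ hω)
  have hmax : IsUniqueMax (S.sigma μ) (w μ) :=
    hdom.isUniqueMax hbox.pos_right.le heven (hw.lt_of_ne μ hμ)
  refine ⟨?_, hmax, ?_, hH.hInfNorm_eq (hmax.le (heven _ hwμ))⟩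
  · linarith [(abs_lt.1 (hbox.abs_gap_sub_gap_lt hβ hμ hwμ)).1]
  · rintro rfl
    by_contra hne
    refine (hw.lt_of_ne μ hμ (-w μ) (by simpa using hwμ) ?_).ne (heven _ hwμ)
    rwa [Ne, neg_eq_self]

end Full

theorem IsUniformBox.exists_reduced_branch (hfull : S.IsUniformBox μs ωs β γ δ n a b)
    (hβ : β ≤ svalMin (S.D μs (Complex.I * ωs))) (hγ : 0 < γ)
    (hgap : 4 * γ ≤ S.sigma μs ωs - S.sigmaSecond μs ωs)
    (hbox : S.IsUniformBox μs ωs β γ δ r a b)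
    {V W : Matrix (Fin n) (Fin r) ℂ} (hstable : (V, W) ∈ S.stablePairs μs ωs β r)
    (hδ : deriv (deriv (S.redSigma V W μs)) ωs ≤ δ)
    {μ₀ : EuclideanSpace ℝ (Fin d)} (hμ₀ : μ₀ ∈ closedBall μs a) {ω₀ : ℝ}
    (hω₀ : ω₀ ∈ closedBall ωs (b / 2)) (hpeak : S.IsPeak μ₀ ω₀)
    (hV : S.newV μ₀ ω₀ ≤ col V) (hW : S.newW μ₀ ω₀ ≤ col W) :
    ∃ w, IsConcaveBranch (S.redSigma V W) μs ωs a b (δ / 2) μ₀ ω₀ w ∧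
      ∀ μ ∈ closedBall μs a, γ ≤ S.redSigma V W μ (w μ) - S.redSigmaSecond V W μ (w μ) := by
  have hω₀b : ω₀ ∈ closedBall ωs b :=
    closedBall_subset_closedBall (half_le_self hbox.pos_right.le) hω₀
  obtain ⟨hdet, hdist⟩ := hbox.det_ne_zero_and_dist_lt μ₀ hμ₀ ω₀ hω₀b _ hstable
  have hgap₀ := (abs_lt.1 (hfull.abs_gap_sub_gap_lt hβ hμ₀ hω₀b)).1
  have hgap_eq : S.redGap (V, W) μ₀ ω₀ = S.sigma μ₀ ω₀ - S.sigmaSecond μ₀ ω₀ := by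
    simp only [redGap, redSigma, redSigmaSecond, sigma, sigmaSecond,
      S.redH_eq_H (isUnit_iff_ne_zero.1 hpeak.2) hdet hV hW]
  have hbase : 2 * γ ≤ S.redGap (V, W) μs ωs := by
    linarith [(abs_lt.1 (Real.dist_eq _ _ ▸ hdist)).2]
  have hpeaked : (V, W) ∈ S.peakedPairs μs ωs β (2 * γ) δ r := ⟨⟨hstable, hbase⟩, hδ⟩
  have hpos : 0 < S.sigma μ₀ ω₀ := by
    have hsecond : 0 ≤ S.sigmaSecond μ₀ ω₀ := sval_nonneg _ 1
    linarith
  obtain ⟨w, hw⟩ := hbox.exists_branch _ hpeaked μ₀ hμ₀ ω₀ hω₀ <|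
    S.hasDerivAt_redSigma_of_isPeak hpeak hdet hV hW hpos
      (hbox.differentiableAt_redSigma hγ hpeaked hμ₀ hω₀b)
  exact ⟨w, hw, fun μ hμ => (hbox.lt_redGap hpeaked hμ (hw.isUnique.1.mapsTo hμ)).le⟩

end ParamSystem

theorem Run.interpolates {d n m p : ℕ} {S : ParamSystem d n m p} {R : Run d n}
    {K : Set (EuclideanSpace ℝ (Fin d))} {k : ℕ} (hk : 1 ≤ k)
    (h : R.IsBasic S K k ∨ R.IsExtended S K k) :
    R.Orthonormal k ∧ S.IsPeak (R.μ k) (R.ω k) ∧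
      S.newV (R.μ k) (R.ω k) ≤ col (R.V k) ∧ S.newW (R.μ k) (R.ω k) ≤ col (R.W k) := by
  rcases h with ⟨horth, h⟩ | ⟨horth, h⟩
  · obtain ⟨hsel, hV, hW⟩ := h k hk le_rfl
    exact ⟨horth k le_rfl, hsel.2.2, hV ▸ le_sup_right, hW ▸ le_sup_right⟩
  · obtain ⟨hsel, -, hV, hW⟩ := h k hk le_rfl
    exact ⟨horth k le_rfl, hsel.2.2, hV ▸ le_sup_of_le_left le_sup_right,
      hW ▸ le_sup_of_le_left le_sup_right⟩

end HinfMin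

theorem proposition3p4_general {d n m p : ℕ} (S : ParamSystem d n m p)
    {μs : EuclideanSpace ℝ (Fin d)} (hμs : μs ∈ S.Ω) (hHinf : ∀ᶠ μ in 𝓝 μs, S.InHinf μ)
    (hcont : TendstoUniformly S.sigma (S.sigma μs) (𝓝 μs))
    {ωs : ℝ} (hmax : IsUniqueMax (S.sigma μs) ωs)
    (hsimple : S.sigmaSecond μs ωs < S.sigma μs ωs)
    {δ β : ℝ} (hδ : δ < 0) (hβ : 0 < β) (hδ_full : deriv (deriv (S.sigma μs)) ωs ≤ δ)
    (hβ_full : β ≤ svalMin (S.D μs (Complex.I * ωs))) :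
    ∃ ρ > 0, ∃ ημ > 0, ∃ ηω > 0, ∃ ε > 0,
      closedBall μs ημ ⊆ S.Ω ∧
      (∃ w : EuclideanSpace ℝ (Fin d) → ℝ,
        IsUniqueStationaryBranch S.sigma μs ωs ημ ηω μs ωs w ∧
        ∀ μ ∈ closedBall μs ημ,
          SecondDerivLE (S.sigma μ) (w μ) (δ / 2) ∧
          ε ≤ S.sigma μ (w μ) - S.sigmaSecond μ (w μ) ∧
          IsUniqueMax (S.sigma μ) (w μ) ∧ (ωs = 0 → w μ = 0) ∧
          S.hInfNorm μ = ENNReal.ofReal (S.sigma μ (w μ))) ∧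
      ∀ {r : ℕ} {V W : Matrix (Fin n) (Fin r) ℂ} {μ₀ : EuclideanSpace ℝ (Fin d)} {ω₀ : ℝ},
        Vᴴ * V = 1 ∧ Wᴴ * W = 1 → dist μ₀ μs < ρ → 0 ≤ ω₀ * ωs → S.IsPeak μ₀ ω₀ →
        S.newV μ₀ ω₀ ≤ col V → S.newW μ₀ ω₀ ≤ col W →
        deriv (deriv (S.redSigma V W μs)) ωs ≤ δ →
        β ≤ svalMin (S.redD V W μs (Complex.I * ωs)) →
        ∃ w : EuclideanSpace ℝ (Fin d) → ℝ,
          IsUniqueStationaryBranch (S.redSigma V W) μs ωs ημ ηω μ₀ ω₀ w ∧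
          ∀ μ ∈ closedBall μs ημ,
            SecondDerivLE (S.redSigma V W μ) (w μ) (δ / 2) ∧
            ε ≤ S.redSigma V W μ (w μ) - S.redSigmaSecond V W μ (w μ) ∧
            (∀ ω ∈ closedBall ωs ηω, ω ≠ w μ → S.redSigma V W μ ω < S.redSigma V W μ (w μ)) ∧
            ∀ ω ∈ closedBall ωs ηω, HasDerivAt (S.redSigma V W μ) 0 ω → ω = w μ := by
  obtain ⟨γ, hγ, hgap⟩ : ∃ γ > 0, 4 * γ ≤ S.sigma μs ωs - S.sigmaSecond μs ωs :=
    ⟨(S.sigma μs ωs - S.sigmaSecond μs ωs) / 4, by linarith, by linarith⟩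
  have hdom {b : ℝ} (hb : 0 < b) : ∀ᶠ μ in 𝓝 μs, IsDominatedAway (S.sigma μ) ωs b :=
    (hmax.isDominatedAway hHinf.self_of_nhds.continuous_sigma hb).eventually_of_tendstoUniformly
      hcont
  obtain ⟨a, b, hbox, hnear⟩ := ParamSystem.exists_isUniformBox (ωs := ωs) hμs hβ hγ hδ
    fun b hb => hHinf.and (hdom hb)
  have hfull := hbox n le_rfl
  obtain ⟨ρ, hρ, hdom_half⟩ := Metric.eventually_nhds_iff.1
    ((hdom (half_pos hfull.pos_right)).and (closedBall_mem_nhds μs hfull.pos_left))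
  refine ⟨ρ, hρ, a, hfull.pos_left, b, hfull.pos_right, γ, hγ, hfull.closedBall_subset, ?_, ?_⟩
  · obtain ⟨w, hw⟩ := hfull.exists_full_branch hβ_full hγ (by linarith) hδ_full hmax
    exact ⟨w, hw.isUnique, fun μ hμ => ⟨hw.secondDerivLE μ hμ,
      hfull.full_branch_properties hβ_full hw (by linarith) hμ (hnear μ hμ).1 (hnear μ hμ).2⟩⟩
  · intro r V W μ₀ ω₀ horth hdist hsign hpeak hV hW hδr hβr
    obtain ⟨hdom₀, hμ₀⟩ := hdom_half hdist
    obtain ⟨w, hw, hgap_w⟩ := hfull.exists_reduced_branch hβ_full hγ hgap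
      (hbox r (le_of_conjTranspose_mul_self horth.1)) ⟨horth, hβr⟩ hδr hμ₀
      (hdom₀.mem_closedBall hpeak.1 hsign) hpeak hV hW
    exact ⟨w, hw.isUnique, fun μ hμ => ⟨hw.secondDerivLE μ hμ, hgap_w μ hμ, hw.lt_of_ne μ hμ,
      hw.eq_of_stationary μ hμ⟩⟩

theorem proposition3p4 {d n m p : ℕ} (S : ParamSystem d n m p)
    -- the compact parameter set, on which (and near the minimizer) the transfer function is in the Hardy space
    (K : Set (EuclideanSpace ℝ (Fin d))) (hK : IsCompact K) (hKΩ : K ⊆ S.Ω)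
    (hHinf : ∀ μ ∈ K, S.InHinf μ)
    (μs : EuclideanSpace ℝ (Fin d)) (hμs : μs ∈ K) (hmin : IsLocalMinOn S.hInfNorm K μs)
    (hHinf_near : ∀ᶠ μ in 𝓝 μs, S.InHinf μ)
    (hcont : TendstoUniformly S.sigma (S.sigma μs) (𝓝 μs))
    -- the smoothness assumption
    (ωs : ℝ) (hmax : IsUniqueMax (S.sigma μs) ωs)
    (hpos : 0 < S.sigma μs ωs) (hsimple : S.sigmaSecond μs ωs < S.sigma μs ωs)
    -- a family of runs of the algorithms with `μ^(k) → μs` as `μ^(1) → μs`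
    (k : ℕ) (hk : 1 ≤ k) {ι : Type*} (R : ι → Run d n)
    (hR : ∀ i, (R i).IsBasic S K k ∨ (R i).IsExtended S K k)
    (hsign : ∀ i, 0 ≤ (R i).ω k * ωs)
    (hconv : Tendsto (fun i => (R i).μ k) (comap (fun i => (R i).μ 1) (𝓝 μs)) (𝓝 μs))
    (δ β : ℝ) (hδ : δ < 0) (hβ : 0 < β)
    (hδ_full : deriv (deriv (S.sigma μs)) ωs ≤ δ)
    (hβ_full : β ≤ svalMin (S.D μs (Complex.I * ωs))) :
    ∃ ρ > 0, ∃ ημ > 0, ∃ ηω > 0, ∃ ε > 0,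
      closedBall μs ημ ⊆ S.Ω ∧
      (∃ w : EuclideanSpace ℝ (Fin d) → ℝ,
        IsUniqueStationaryBranch S.sigma μs ωs ημ ηω μs ωs w ∧
        ∀ μ ∈ closedBall μs ημ,
          SecondDerivLE (S.sigma μ) (w μ) (δ / 2) ∧
          ε ≤ S.sigma μ (w μ) - S.sigmaSecond μ (w μ) ∧
          IsUniqueMax (S.sigma μ) (w μ) ∧ (ωs = 0 → w μ = 0) ∧
          S.hInfNorm μ = ENNReal.ofReal (S.sigma μ (w μ))) ∧
      ∀ i, dist ((R i).μ 1) μs < ρ →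
        deriv (deriv (S.redSigma ((R i).V k) ((R i).W k) μs)) ωs ≤ δ →
        β ≤ svalMin (S.redD ((R i).V k) ((R i).W k) μs (Complex.I * ωs)) →
        ∃ w : EuclideanSpace ℝ (Fin d) → ℝ,
          IsUniqueStationaryBranch (S.redSigma ((R i).V k) ((R i).W k)) μs ωs ημ ηω
            ((R i).μ k) ((R i).ω k) w ∧
          ∀ μ ∈ closedBall μs ημ,
            SecondDerivLE (S.redSigma ((R i).V k) ((R i).W k) μ) (w μ) (δ / 2) ∧
            ε ≤ S.redSigma ((R i).V k) ((R i).W k) μ (w μ) -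
              S.redSigmaSecond ((R i).V k) ((R i).W k) μ (w μ) ∧
            (∀ ω ∈ closedBall ωs ηω, ω ≠ w μ →
              S.redSigma ((R i).V k) ((R i).W k) μ ω <
                S.redSigma ((R i).V k) ((R i).W k) μ (w μ)) ∧
            ∀ ω ∈ closedBall ωs ηω,
              HasDerivAt (S.redSigma ((R i).V k) ((R i).W k) μ) 0 ω → ω = w μ := by
  obtain ⟨ρ, hρ, ημ, hημ, ηω, hηω, ε, hε, hΩ, hfull, hred⟩ :=
    proposition3p4_general S (hKΩ hμs) hHinf_near hcont hmax hsimple hδ hβ hδ_full hβ_full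
  obtain ⟨ρ₁, hρ₁, hρ₁ρ⟩ := ((nhds_basis_ball.comap _).tendsto_iff nhds_basis_ball).1 hconv ρ hρ
  refine ⟨ρ₁, hρ₁, ημ, hημ, ηω, hηω, ε, hε, hΩ, hfull, fun i hi => ?_⟩
  obtain ⟨horth, hpeak, hV, hW⟩ := Run.interpolates hk (hR i)
  exact hred horth (hρ₁ρ i hi) (hsign i) hpeak hV hW
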